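/- Setting. Let $\mathsf X\subseteq\mathbb R^d$ be open and let $K\subseteq\mathsf X$ be nonempty, compact and convex. Let $f:\mathsf X\to\mathbb R$ be continuously differentiable and let $g:\mathsf X\to\mathbb R$ be locally Lipschitz, bounded from below and Clarke regular (all one-sided directional derivatives exist and equal the generalized directional derivative). Let $\gamma_k>0$ ($k\ge1$) satisfy $\sum_k\gamma_k=\infty$ and $\gamma_k\to0$. Let $(\mathsf Z,\mathcal Z)$ be a measurable space and, for $x\in\mathsf X$, let $M_x$ be a Markov kernel on $\mathsf Z$ with invariant probability measure $\pi_x$. Let $\Phi:K\times\mathsf Z\to\mathbb R^d$ be measurable with $\Phi(x,\cdot)$ $\pi_x$-integrable and $\nabla f(x)=\int_{\mathsf Z}\Phi(x,z)\,\pi_x(\mathrm dz)$ for all $x\in K$. For $V:\mathsf Z\to[1,\infty)$ measurable put $\|h\|_V=\sup_z\|h(z)\|/V(z)$ and, for a finite signed measure $\mu$, $\|\mu\|_V=\sup\{\mu(h): h:\mathsf Z\to\mathbb R \text{ measurable},\ \|h\|_V\le1,\ \mu(h)\text{ well defined}\}$; put $D_V(x,x')=\sup_z\|M_x(z,\cdot)-M_{x'}(z,\cdot)\|_V/V(z)$.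 Let $W:\mathsf Z\to[1,\infty)$ be measurable and assume: (B1) $\sup_{x\in K}\|\Phi(x,\cdot)\|_{W^{1/2}}<\infty$; there are $\lambda\in[0,1)$ and $b<\infty$ with $\sup_{x\in K}M_xW\le\lambda W+b$; and for every $\ell\in(0,1]$ there are $C<\infty$ and $\rho\in(0,1)$ with $\sup_{x\in K}\|M_x^n(z,\cdot)-\pi_x\|_{W^\ell}\le C\rho^nW^\ell(z)$ for all $z\in\mathsf Z$ and $n\ge0$. (B2) There is $C<\infty$ with $\|\Phi(x,\cdot)-\Phi(x',\cdot)\|_{W^{1/2}}+D_{W^{1/2}}(x,x')\le C\|x-x'\|$ for all $x,x'\in K$. On a probability space with a filtration $(\mathcal F_k)_{k\ge0}$, let $(x_k)_{k\ge0}$ and $(z_k)_{k\ge1}$ be adapted, with $x_0\in K$, such that for every $k\ge1$ the conditional law of $z_{k+1}$ given $\mathcal F_k$ is $M_{x_k}(z_k,\cdot)$. Write $\mathrm{prox}_{\gamma\varphi}(x)=\operatorname{argmin}_{y\in\mathsf X}\{\varphi(y)+\|y-x\|^2/(2\gamma)\}$ (a set), $\Pi_K$ for the projection onto $K$, and $\mathbb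 I_K$ for the indicator function of $K$ ($0$ on $K$, $+\infty$ elsewhere). Suppose that either $$x_k\in\mathrm{prox}_{\gamma_k(g+\mathbb I_K)}\bigl(x_{k-1}-\gamma_k\Phi(x_{k-1},z_k)\bigr)\quad\text{for all }k\ge1,$$ or $$x_k\in\Pi_K\bigl(\mathrm{prox}_{\gamma_kg}(x_{k-1}-\gamma_k\Phi(x_{k-1},z_k))\bigr)\quad\text{for all }k\ge1.$$ Proposition. Suppose that $\mathbb E[W(z_1)]<\infty$, $\sum_k|\gamma_{k-1}-\gamma_k|<\infty$ and $\sum_k\gamma_k^2<\infty$. Let $\delta_k=\Phi(x_{k-1},z_k)-\nabla f(x_{k-1})$ for $k\ge1$. Then, almost surely, the gradient noise can be decomposed as $\delta_k=e_k+r_k$ ($k\ge1$) with $\|r_k\|\to0$ and $\sum_{k\ge1}\gamma_ke_k$ convergent; indeed, almost surely, the series $\sum_{k\ge1}\gamma_k\delta_k$ converges. -/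

import Mathlib

open MeasureTheory ProbabilityTheory Filter Topology Set
open scoped ENNReal

noncomputable section

namespace ProxSGD

/-! ### Nonsmooth analysis: generalized directional derivative, regularity, prox, projection -/

section Analysis

variable {E : Type*} [NormedAddCommGroup E] [InnerProductSpace ℝ E]

/-- Clarke's generalized directional derivative of `g` at `x` in the direction `h`: the upper limit
of `(g (y + t h) - g y) / t` as `y → x` and `t ↓ 0`. -/
def clarkeDeriv (g : E → ℝ) (x h : E) : ℝ :=
  limsup (fun p : E × ℝ => (g (p.1 + p.2 • h) - g p.1) / p.2) (𝓝 x ×ˢ 𝓝[>] (0 : ℝ))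

/-- `g` is (Clarke) regular at `x`: every one-sided directional derivative exists and equals the
generalized directional derivative. -/
def IsRegularAt (g : E → ℝ) (x : E) : Prop :=
  ∀ h : E, Tendsto (fun t : ℝ => (g (x + t • h) - g x) / t) (𝓝[>] 0) (𝓝 (clarkeDeriv g x h))

/-- The convex indicator function of `K`: `0` on `K` and `+∞` outside. -/
def convexIndicator (K : Set E) (x : E) : EReal :=
  open Classical in if x ∈ K then 0 else ⊤

/-- The (set-valued) proximal operator over `X` of an extended-real-valued function `φ`:
the set of minimizers over `y ∈ X` of `φ y + ‖y - x‖² / (2 γ)`. -/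
def prox (X : Set E) (γ : ℝ) (φ : E → EReal) (x : E) : Set E :=
  {y | y ∈ X ∧ ∀ y' ∈ X, φ y + (((2 * γ)⁻¹ * ‖y - x‖ ^ 2 : ℝ) : EReal) ≤
    φ y' + (((2 * γ)⁻¹ * ‖y' - x‖ ^ 2 : ℝ) : EReal)}

/-- The projection of a set `A` onto `K`: all points of `K` that are nearest to some `a ∈ A`. -/
def projSet (K A : Set E) : Set E :=
  {p | ∃ a ∈ A, p ∈ K ∧ ∀ q ∈ K, ‖a - p‖ ≤ ‖a - q‖}

/-- The composite objective `f + g` on the open set `X`: `f` is continuously differentiable and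
`g` is locally Lipschitz, bounded from below and regular on `X`. -/
structure CompositeObjective (X : Set E) (f g : E → ℝ) : Prop where
  isOpen : IsOpen X
  contDiff : ContDiffOn ℝ 1 f X
  locallyLipschitz : LocallyLipschitzOn X g
  bddBelow : BddBelow (g '' X)
  regular : ∀ x ∈ X, IsRegularAt g x

/-- Positive step sizes `γ 1, γ 2, …` with divergent sum and limit zero. -/
structure StepSizes (γ : ℕ → ℝ) : Prop where
  pos : ∀ k, 1 ≤ k → 0 < γ k
  sum_diverges : Tendsto (fun n : ℕ => ∑ k ∈ Finset.Icc 1 n, γ k) atTop atTop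
  tendsto_zero : Tendsto γ atTop (𝓝 0)

/-- The series `∑_{k ≥ 1} v k` converges, i.e. its partial sums have a limit. -/
def SeriesConverges (v : ℕ → E) : Prop :=
  ∃ s : E, Tendsto (fun n : ℕ => ∑ k ∈ Finset.Icc 1 n, v k) atTop (𝓝 s)

/-- The noise condition: `δ k = e k + r k` for `k ≥ 1`, where `‖r k‖ → 0` and the series
`∑_{k ≥ 1} γ k • e k` converges. -/
def NoiseCondition (γ : ℕ → ℝ) (δ : ℕ → E) : Prop :=
  ∃ e r : ℕ → E, (∀ k, 1 ≤ k → δ k = e k + r k) ∧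
    Tendsto (fun k => ‖r k‖) atTop (𝓝 0) ∧ SeriesConverges (fun k => γ k • e k)

/-- First projected scheme: `x_k ∈ prox_{γ_k (g + 𝕀_K)} (x_{k-1} - γ_k H_k)` for `k ≥ 1`. -/
def IndicatorProxScheme (X K : Set E) (g : E → ℝ) (γ : ℕ → ℝ) (x H : ℕ → E) : Prop :=
  ∀ k : ℕ, x (k + 1) ∈ prox X (γ (k + 1)) (fun y => (g y : EReal) + convexIndicator K y)
    (x k - γ (k + 1) • H (k + 1))

/-- Second projected scheme: `x_k ∈ Π_K (prox_{γ_k g} (x_{k-1} - γ_k H_k))` for `k ≥ 1`. -/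
def ProjectedProxScheme (X K : Set E) (g : E → ℝ) (γ : ℕ → ℝ) (x H : ℕ → E) : Prop :=
  ∀ k : ℕ, x (k + 1) ∈ projSet K (prox X (γ (k + 1)) (fun y => (g y : EReal))
    (x k - γ (k + 1) • H (k + 1)))

end Analysis

/-! ### Weighted norms and families of Markov kernels -/

section Kernels

variable {Z : Type*}

/-- The `W`-norm `sup_z ‖h z‖ / W z`, with values in `[0, ∞]`. -/
def wNorm {G : Type*} [NormedAddCommGroup G] (W : Z → ℝ) (h : Z → G) : ℝ≥0∞ :=
  ⨆ z, ‖h z‖ₑ / ENNReal.ofReal (W z)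

variable [MeasurableSpace Z]

/-- The `W`-variation `‖μ - ν‖_W` of the signed measure `μ - ν` (`μ`, `ν` finite measures):
the supremum of `(μ - ν)(h) = μ h - ν h` over all measurable real `h` with `W`-norm at most `1`
for which these integrals are defined. The bounded `h` alone already give the total mass of `W`
under `|μ - ν|`, which is the value `∞` if that mass is infinite. -/
def wVariation (W : Z → ℝ) (μ ν : Measure Z) : ℝ≥0∞ :=
  ⨆ (h : Z → ℝ) (_ : Measurable h) (_ : wNorm W h ≤ 1) (_ : Integrable h μ) (_ : Integrable h ν),
    ENNReal.ofReal (∫ z, h z ∂μ - ∫ z, h z ∂ν)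

/-- The `W`-variation `sup_z ‖P(z,·) - Q(z,·)‖_W / W z` between two kernels. -/
def kernelWVariation (W : Z → ℝ) (P Q : Kernel Z Z) : ℝ≥0∞ :=
  ⨆ z, wVariation W (P z) (Q z) / ENNReal.ofReal (W z)

variable {E : Type*} [NormedAddCommGroup E]

/-- Uniform-in-`x ∈ K` geometric ergodicity of the kernels `M x` towards `π x`, with the weight
function `W`: `Φ x` is uniformly bounded in `W^{1/2}`-norm, `W` satisfies a uniform drift
condition, and for all `ℓ ∈ (0,1]` the iterates `(M x)^n` (the `n`-fold composition) converge
geometrically to `π x` in `W^ℓ`-variation. -/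
structure UniformlyErgodic (K : Set E) (Φ : E → Z → E) (M : E → Kernel Z Z) (π : E → Measure Z)
    (W : Z → ℝ) : Prop where
  measurable_weight : Measurable W
  one_le_weight : ∀ z, 1 ≤ W z
  gradient_bound : ⨆ x ∈ K, wNorm (fun z => W z ^ (1 / 2 : ℝ)) (Φ x) < ⊤
  drift : ∃ lam b : ℝ, 0 ≤ lam ∧ lam < 1 ∧ ∀ z,
    ⨆ x ∈ K, ∫⁻ y, ENNReal.ofReal (W y) ∂(M x z) ≤ ENNReal.ofReal (lam * W z + b)
  ergodic : ∀ ℓ : ℝ, 0 < ℓ → ℓ ≤ 1 → ∃ C ρ : ℝ, 0 < ρ ∧ ρ < 1 ∧ ∀ (n : ℕ) (z : Z),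
    ⨆ x ∈ K, wVariation (fun y => W y ^ ℓ) ((M x ^ n) z) (π x) ≤
      ENNReal.ofReal (C * ρ ^ n * W z ^ ℓ)

/-- Lipschitz dependence on `x ∈ K` of `Φ x` and of the kernels `M x`, in `W^{1/2}`-norm and
`W^{1/2}`-variation. -/
def LipschitzInParameter (K : Set E) (Φ : E → Z → E) (M : E → Kernel Z Z) (W : Z → ℝ) : Prop :=
  ∃ C : ℝ, ∀ x ∈ K, ∀ x' ∈ K,
    wNorm (fun z => W z ^ (1 / 2 : ℝ)) (fun z => Φ x z - Φ x' z) +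
      kernelWVariation (fun z => W z ^ (1 / 2 : ℝ)) (M x) (M x') ≤ ENNReal.ofReal (C * ‖x - x'‖)

/-- The state-dependent Markovian dynamic: with respect to the filtration `ℱ`, to which the
parameters `x` and the samples `z 1, z 2, …` are adapted, the conditional law of `z (k + 1)`
given the past `ℱ k` is `M (x k) (z k, ·)`. -/
structure MarkovianDynamic {Ω : Type*} [MeasurableSpace Ω] [MeasurableSpace E] (P : Measure Ω)
    (ℱ : Filtration ℕ ‹MeasurableSpace Ω›) (M : E → Kernel Z Z) (x : ℕ → Ω → E) (z : ℕ → Ω → Z) :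
    Prop where
  measurable_param : ∀ k, Measurable[ℱ k] (x k)
  measurable_sample : ∀ k, 1 ≤ k → Measurable[ℱ k] (z k)
  transition : ∀ k, 1 ≤ k → ∀ A : Set Z, MeasurableSet A →
    P⟦z (k + 1) ⁻¹' A | ℱ k⟧ =ᵐ[P] fun ω => (M (x k ω) (z k ω)).real A

end Kernels

end ProxSGD

end

/-! The method is that of the Poisson equation. Let h_x be a coordinate of Φ x and V = W^(1/2). By
geometric ergodicity the series G_x = ∑ (M_x^n h_x - π_x h_x) converges, is O(V), and satisfies G_x
- u_x = h_x - π_x h_x with u_x = M_x G_x. The noise at step k+1 is therefore G_{x_k}(z_{k+1}) -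
u_{x_k}(z_{k+1}), and γ_{k+1} times it is the sum of (a) γ_{k+1} (G_{x_k}(z_{k+1}) - u_{x_k}(z_k)),
(b) γ_k u_{x_k}(z_k) - γ_{k+1} u_{x_{k+1}}(z_{k+1}), (c) (γ_{k+1} - γ_k) u_{x_k}(z_k), (d) γ_{k+1}
(u_{x_{k+1}}(z_{k+1}) - u_{x_k}(z_{k+1})).

The drift bounds E W(z_k) = E V(z_k)² uniformly in k ≥ 1. So (a) is a martingale difference with
second moment O(γ_{k+1}²); (b) telescopes; (c) is dominated by |γ_{k+1} - γ_k| V(z_k); (d) is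
dominated by γ_{k+1}² V(z_{k+1})², one factor V coming from the size of u and one from the increment
of x. All four series converge almost surely (`ae_tendsto_sum_noise`).

The bound on (d) needs two facts. First, u_x is Lipschitz in x: a function is known up to its mean
from its defect w - Qw (`poisson_defect`), and the difference of two Poisson solutions has a small
defect and a small mean (`abs_poisson_sub_poisson_le`). Second, x_{k+1} - x_k is O(γ_{k+1}
V(z_{k+1})), because g decreases at most linearly away from K (`exists_sub_le_mul_norm`,
`mem_and_norm_sub_le_of_scheme`). -/

noncomputable section

namespace ProxSGD

/-! ### The Poisson equation for a geometrically ergodic kernel -/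

section Poisson

variable {Z : Type*} [MeasurableSpace Z]

/-- Geometric ergodicity of `Q` towards its invariant law `μ`, in the weighted norm of `V`, with
explicit constants and expressed through integrals of functions dominated by `V`. -/
structure IsGeomErgodic (V : Z → ℝ) (Q : Kernel Z Z) (μ : Measure Z) (C ρ : ℝ) : Prop where
  measurable : Measurable V
  one_le : ∀ z, 1 ≤ V z
  markov : IsMarkovKernel Q
  isProb : IsProbabilityMeasure μ
  invariant : Kernel.Invariant Q μ
  const_nonneg : 0 ≤ C
  rate_nonneg : 0 ≤ ρ
  rate_lt_one : ρ < 1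
  integrable_pow : ∀ n z, Integrable V ((Q ^ n) z)
  integrable : Integrable V μ
  bound : ∀ (n : ℕ) (z : Z) (h : Z → ℝ), Measurable h → (∀ y, |h y| ≤ V y) →
    |∫ y, h y ∂((Q ^ n) z) - ∫ y, h y ∂μ| ≤ C * ρ ^ n * V z

/-- The solution `∑ n, (Qⁿ h - μ h)` of the Poisson equation `u - Q u = h - μ h`. -/
def poisson (Q : Kernel Z Z) (μ : Measure Z) (h : Z → ℝ) (z : Z) : ℝ :=
  ∑' n : ℕ, (∫ y, h y ∂((Q ^ n) z) - ∫ y, h y ∂μ)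

lemma isMarkovKernel_pow (Q : Kernel Z Z) [IsMarkovKernel Q] (n : ℕ) : IsMarkovKernel (Q ^ n) := by
  induction n with
  | zero => exact inferInstanceAs (IsMarkovKernel Kernel.id)
  | succ n ih => rw [pow_succ]; exact inferInstanceAs (IsMarkovKernel ((Q ^ n) ∘ₖ Q))

lemma integral_kernel_pow_succ {Q : Kernel Z Z} {n : ℕ} {z : Z} {h : Z → ℝ}
    (hh : Integrable h ((Q ^ (n + 1)) z)) :
    ∫ y, h y ∂((Q ^ (n + 1)) z) = ∫ y, ∫ y', h y' ∂(Q y) ∂((Q ^ n) z) := by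
  have e : Q ^ (n + 1) = Q ∘ₖ (Q ^ n) := pow_succ' Q n
  rw [e] at hh ⊢
  exact Kernel.integral_comp hh

lemma integral_kernel_pow_succ' {Q : Kernel Z Z} {n : ℕ} {z : Z} {h : Z → ℝ}
    (hh : Integrable h ((Q ^ (n + 1)) z)) :
    ∫ y, h y ∂((Q ^ (n + 1)) z) = ∫ y, ∫ y', h y' ∂((Q ^ n) y) ∂(Q z) := by
  have e : Q ^ (n + 1) = (Q ^ n) ∘ₖ Q := pow_succ Q n
  rw [e] at hh ⊢
  exact Kernel.integral_comp hh

lemma integral_integral_of_invariant {Q : Kernel Z Z} {μ : Measure Z}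
    (hQ : Kernel.Invariant Q μ) {h : Z → ℝ} (hh : Integrable h μ) :
    Integrable (fun z => ∫ y, h y ∂(Q z)) μ ∧ ∫ z, ∫ y, h y ∂(Q z) ∂μ = ∫ z, h z ∂μ := by
  -- Seen as a kernel from a point, μ turns invariance into a statement about composition of
  -- kernels.
  have e : (Q ∘ₖ Kernel.const Unit μ) () = μ := by
    rw [← Measure.comp_eq_comp_const_apply]; exact hQ
  have hh' : Integrable h ((Q ∘ₖ Kernel.const Unit μ) ()) := by rwa [e]
  refine ⟨by simpa using hh'.integral_comp, ?_⟩
  have := Kernel.integral_comp hh'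
  rw [e] at this
  simpa using this.symm

lemma integrable_of_abs_le_mul {V : Z → ℝ} {ν : Measure Z} (hν : Integrable V ν)
    {h : Z → ℝ} {c : ℝ} (hm : Measurable h) (hc : ∀ y, |h y| ≤ c * V y) : Integrable h ν :=
  (hν.const_mul c).mono' hm.aestronglyMeasurable (ae_of_all _ hc)

lemma abs_integral_le_mul {V : Z → ℝ} {ν : Measure Z} (hν : Integrable V ν)
    {h : Z → ℝ} {c : ℝ} (hc : ∀ y, |h y| ≤ c * V y) : |∫ y, h y ∂ν| ≤ c * ∫ y, V y ∂ν := by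
  rw [← integral_const_mul]
  exact norm_integral_le_of_norm_le (f := h) (hν.const_mul c) (ae_of_all _ hc)

namespace IsGeomErgodic

variable {V : Z → ℝ} {Q : Kernel Z Z} {μ : Measure Z} {C ρ : ℝ}

lemma weight_pos (H : IsGeomErgodic V Q μ C ρ) (z : Z) : 0 < V z := by
  linarith [H.one_le z]

lemma integrable_kernel (H : IsGeomErgodic V Q μ C ρ) (z : Z) : Integrable V (Q z) := by
  simpa using H.integrable_pow 1 z

lemma bound_mul (H : IsGeomErgodic V Q μ C ρ) {h : Z → ℝ} {c : ℝ} (hm : Measurable h)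
    (hc : ∀ y, |h y| ≤ c * V y) (n : ℕ) (z : Z) :
    |∫ y, h y ∂((Q ^ n) z) - ∫ y, h y ∂μ| ≤ c * (C * V z) * ρ ^ n := by
  have hc0 : 0 ≤ c := nonneg_of_mul_nonneg_left ((abs_nonneg _).trans (hc z)) (H.weight_pos z)
  rcases hc0.eq_or_lt with rfl | hc0
  · have : h = fun _ => 0 := by
      ext y; simpa using hc y
    simp [this]
  · have := H.bound n z (fun y => c⁻¹ * h y) (hm.const_mul _) (fun y => by
      rw [abs_mul, abs_of_pos (inv_pos.2 hc0), inv_mul_le_iff₀ hc0]; exact hc y)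
    rw [integral_const_mul, integral_const_mul, ← mul_sub, abs_mul, abs_of_pos (inv_pos.2 hc0),
      inv_mul_le_iff₀ hc0] at this
    linarith

lemma summable_bound (H : IsGeomErgodic V Q μ C ρ) (c : ℝ) :
    HasSum (fun n : ℕ => c * ρ ^ n) (c * (1 - ρ)⁻¹) :=
  (hasSum_geometric_of_lt_one H.rate_nonneg H.rate_lt_one).mul_left c

lemma summable_poisson (H : IsGeomErgodic V Q μ C ρ) {h : Z → ℝ} {c : ℝ} (hm : Measurable h)
    (hc : ∀ y, |h y| ≤ c * V y) (z : Z) :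
    Summable fun n : ℕ => ∫ y, h y ∂((Q ^ n) z) - ∫ y, h y ∂μ :=
  Summable.of_norm_bounded (H.summable_bound _).summable (H.bound_mul hm hc · z)

lemma abs_poisson_le (H : IsGeomErgodic V Q μ C ρ) {h : Z → ℝ} {c : ℝ} (hm : Measurable h)
    (hc : ∀ y, |h y| ≤ c * V y) (z : Z) :
    |poisson Q μ h z| ≤ c * (C * (1 - ρ)⁻¹) * V z := by
  have := tsum_of_norm_bounded (H.summable_bound _)
    (f := fun n : ℕ => ∫ y, h y ∂((Q ^ n) z) - ∫ y, h y ∂μ) (H.bound_mul hm hc · z)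
  calc _ ≤ _ := this
    _ = _ := by ring

lemma measurable_poisson {h : Z → ℝ} (hm : Measurable h) :
    Measurable (poisson Q μ h) :=
  Measurable.tsum fun _ => hm.stronglyMeasurable.integral_kernel.measurable.sub_const _

/-- The Poisson equation. -/
lemma poisson_sub_integral (H : IsGeomErgodic V Q μ C ρ) {h : Z → ℝ} {c : ℝ} (hm : Measurable h)
    (hc : ∀ y, |h y| ≤ c * V y) (z : Z) :
    poisson Q μ h z - ∫ y, poisson Q μ h y ∂(Q z) = h z - ∫ y, h y ∂μ := by
  have := H.markov
  have hi : ∀ n y, Integrable h ((Q ^ n) y) := fun n y =>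
    integrable_of_abs_le_mul (H.integrable_pow n y) hm hc
  have hmn : ∀ n, Measurable fun y => ∫ y', h y' ∂((Q ^ n) y) - ∫ y, h y ∂μ := fun n =>
    hm.stronglyMeasurable.integral_kernel.measurable.sub_const _
  have hle : ∀ n y, |∫ y', h y' ∂((Q ^ n) y) - ∫ y, h y ∂μ| ≤ c * C * ρ ^ n * V y := fun n y =>
    (H.bound_mul hm hc n y).trans_eq (by ring)
  have hF : ∀ n, Integrable (fun y => ∫ y', h y' ∂((Q ^ n) y) - ∫ y, h y ∂μ) (Q z) := fun n =>
    integrable_of_abs_le_mul (H.integrable_kernel z) (hmn n) (hle n)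
  have hs : HasSum (fun n : ℕ => ∫ y, (∫ y', h y' ∂((Q ^ n) y) - ∫ y, h y ∂μ) ∂(Q z))
      (∫ y, poisson Q μ h y ∂(Q z)) := by
    refine hasSum_integral_of_summable_integral_norm hF ?_
    refine Summable.of_nonneg_of_le (fun n => integral_nonneg fun _ => norm_nonneg _) (fun n => ?_)
      (H.summable_bound (c * C * ∫ y, V y ∂(Q z))).summable
    calc ∫ y, ‖∫ y', h y' ∂((Q ^ n) y) - ∫ y, h y ∂μ‖ ∂(Q z)
        ≤ ∫ y, c * C * ρ ^ n * V y ∂(Q z) :=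
          integral_mono (hF n).norm ((H.integrable_kernel z).const_mul _) (hle n)
      _ = _ := by rw [integral_const_mul]; ring
  have e : ∀ n, ∫ y, (∫ y', h y' ∂((Q ^ n) y) - ∫ y, h y ∂μ) ∂(Q z) =
      ∫ y, h y ∂((Q ^ (n + 1)) z) - ∫ y, h y ∂μ := fun n => by
    have h1 : Integrable (fun y => ∫ y', h y' ∂((Q ^ n) y)) (Q z) := by
      refine ((hF n).add (integrable_const (∫ y, h y ∂μ))).congr (ae_of_all _ fun y => ?_)
      simp
    rw [integral_sub h1 (integrable_const _), integral_kernel_pow_succ' (hi _ _)]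
    simp
  simp_rw [e] at hs
  -- Applying Q shifts the series by one index, so only the term n = 0, that is h z - μ h, survives
  -- in the difference.
  have h2 := (H.summable_poisson hm hc z).tsum_eq_zero_add
  rw [hs.tsum_eq, pow_zero, show (1 : Kernel Z Z) = Kernel.id from rfl] at h2
  rw [poisson, h2, Kernel.id_apply, integral_dirac' _ _ hm.stronglyMeasurable]
  ring

/-- A function is recovered, up to its mean, from its defect `w - Q w`. -/
lemma poisson_defect (H : IsGeomErgodic V Q μ C ρ) {w r : Z → ℝ} {c q : ℝ} (hw : Measurable w)
    (hc : ∀ y, |w y| ≤ c * V y) (hr : Measurable r) (hq : ∀ y, |r y| ≤ q * V y)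
    (hwr : ∀ y, r y = w y - ∫ y', w y' ∂(Q y)) (z : Z) :
    poisson Q μ r z = w z - ∫ y, w y ∂μ := by
  have hwμ := integrable_of_abs_le_mul H.integrable hw hc
  have hinv := integral_integral_of_invariant H.invariant hwμ
  have hi : ∀ n, Integrable w ((Q ^ n) z) := fun n =>
    integrable_of_abs_le_mul (H.integrable_pow n z) hw hc
  have hir : ∀ n, Integrable r ((Q ^ n) z) := fun n =>
    integrable_of_abs_le_mul (H.integrable_pow n z) hr hq
  have hrμ : ∫ y, r y ∂μ = 0 := by
    simp_rw [hwr]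
    rw [integral_sub hwμ hinv.1, hinv.2, sub_self]
  -- The series telescopes: Qⁿ r = Qⁿ w - Qⁿ⁺¹ w, and r has mean zero by invariance.
  have e : ∀ n, ∫ y, r y ∂((Q ^ n) z) - ∫ y, r y ∂μ =
      ∫ y, w y ∂((Q ^ n) z) - ∫ y, w y ∂((Q ^ (n + 1)) z) := fun n => by
    rw [hrμ, sub_zero, integral_kernel_pow_succ (hi _)]
    rw [← integral_sub (hi n)]
    · simp_rw [hwr]
    · have := (hi n).sub (hir n)
      refine this.congr (ae_of_all _ fun y => ?_)
      simp [hwr]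
  have hs := (H.summable_poisson hr hq z).hasSum.tendsto_sum_nat
  simp_rw [e, Finset.sum_range_sub'] at hs
  rw [pow_zero, show (1 : Kernel Z Z) = Kernel.id from rfl, Kernel.id_apply,
    integral_dirac' _ _ hw.stronglyMeasurable] at hs
  have hlim : Tendsto (fun n => ∫ y, w y ∂((Q ^ n) z)) atTop (𝓝 (∫ y, w y ∂μ)) := by
    have h0 : Tendsto (fun n => ∫ y, w y ∂((Q ^ n) z) - ∫ y, w y ∂μ) atTop (𝓝 0) :=
      squeeze_zero_norm (H.bound_mul hw hc · z) (H.summable_bound _).summable.tendsto_atTop_zero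
    simpa using h0.add_const (∫ y, w y ∂μ)
  have := tendsto_nhds_unique hs (hlim.const_sub (w z))
  rw [← this, poisson]
  exact tsum_congr e

/-- The a priori bound for the Poisson equation. -/
lemma abs_sub_integral_le (H : IsGeomErgodic V Q μ C ρ) {w : Z → ℝ} {c q : ℝ} (hw : Measurable w)
    (hc : ∀ y, |w y| ≤ c * V y) (hq : ∀ y, |w y - ∫ y', w y' ∂(Q y)| ≤ q * V y) (z : Z) :
    |w z - ∫ y, w y ∂μ| ≤ q * (C * (1 - ρ)⁻¹) * V z := by
  have hr : Measurable fun y => w y - ∫ y', w y' ∂(Q y) :=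
    hw.sub hw.stronglyMeasurable.integral_kernel.measurable
  rw [← H.poisson_defect hw hc hr hq (fun _ => rfl) z]
  exact H.abs_poisson_le hr hq z

/-- The solution u has defect h - μ h, so `poisson_defect` gives `poisson` of h - μ h as u - μ u.
But `poisson` ignores constants added to h, so this is also u; hence μ u = 0. -/
lemma integral_poisson (H : IsGeomErgodic V Q μ C ρ) {h : Z → ℝ} {c : ℝ} (hm : Measurable h)
    (hc : ∀ y, |h y| ≤ c * V y) : ∫ y, poisson Q μ h y ∂μ = 0 := by
  have := H.isProb
  obtain ⟨z⟩ : Nonempty Z := nonempty_of_isProbabilityMeasure μ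
  have hr : Measurable fun y => h y - ∫ y', h y' ∂μ := hm.sub_const _
  have hq : ∀ y, |h y - ∫ y', h y' ∂μ| ≤ (c + c * ∫ y, V y ∂μ) * V y := fun y => by
    have h1 := abs_integral_le_mul H.integrable hc
    calc |h y - ∫ y', h y' ∂μ| ≤ |h y| + |∫ y', h y' ∂μ| := abs_sub _ _
      _ ≤ c * V y + (c * ∫ y, V y ∂μ) * V y :=
        add_le_add (hc y) (h1.trans (le_mul_of_one_le_right ((abs_nonneg _).trans h1)
          (H.one_le y)))
      _ = _ := by ring
  have h1 := H.poisson_defect (measurable_poisson hm) (H.abs_poisson_le hm hc) hr hq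
    (fun y => (H.poisson_sub_integral hm hc y).symm) z
  have h2 : poisson Q μ (fun y => h y - ∫ y', h y' ∂μ) z = poisson Q μ h z := by
    have := H.markov
    refine tsum_congr fun n => ?_
    have := isMarkovKernel_pow Q n
    rw [integral_sub (integrable_of_abs_le_mul (H.integrable_pow n z) hm hc) (integrable_const _),
      integral_sub (integrable_of_abs_le_mul H.integrable hm hc) (integrable_const _)]
    simp
  linarith

end IsGeomErgodic

end Poisson

/-! ### Perturbation of the Poisson solution -/

section Perturbation

variable {Z : Type*} [MeasurableSpace Z]

namespace IsGeomErgodic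

variable {V : Z → ℝ} {Q Q' : Kernel Z Z} {μ μ' : Measure Z} {C ρ : ℝ}

/-- Invariant laws of nearby kernels are close. -/
lemma abs_integral_sub_integral_le (H : IsGeomErgodic V Q μ C ρ) (H' : IsGeomErgodic V Q' μ' C ρ)
    {D B : ℝ} (hD0 : 0 ≤ D)
    (hD : ∀ (h : Z → ℝ) (c : ℝ), Measurable h → (∀ y, |h y| ≤ c * V y) →
      ∀ z, |∫ y, h y ∂(Q z) - ∫ y, h y ∂(Q' z)| ≤ c * D * V z)
    (hB : ∫ y, V y ∂μ ≤ B) {h : Z → ℝ} {c : ℝ} (hc0 : 0 ≤ c) (hm : Measurable h)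
    (hc : ∀ y, |h y| ≤ c * V y) :
    |∫ y, h y ∂μ - ∫ y, h y ∂μ'| ≤ c * (C * (1 - ρ)⁻¹) * D * B := by
  have := H.isProb
  have hS : 0 ≤ C * (1 - ρ)⁻¹ := mul_nonneg H.const_nonneg
    (inv_nonneg.2 (by linarith [H.rate_lt_one]))
  set v := poisson Q' μ' h with hv
  have hvm : Measurable v := measurable_poisson hm
  have hvc := H'.abs_poisson_le hm hc
  have hvμ : Integrable v μ := integrable_of_abs_le_mul H.integrable hvm hvc
  have hhμ : Integrable h μ := integrable_of_abs_le_mul H.integrable hm hc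
  have hinv := integral_integral_of_invariant H.invariant hvμ
  have hQ' : ∀ z, ∫ y, v y ∂(Q' z) = v z - (h z - ∫ y, h y ∂μ') := fun z => by
    linarith [H'.poisson_sub_integral hm hc z]
  have hi' : Integrable (fun z => ∫ y, v y ∂(Q' z)) μ := by
    simp_rw [hQ']
    exact hvμ.sub (hhμ.sub (integrable_const _))
  -- Integrate h - μ' h = v - Q' v against μ and replace μ v by μ Q v.
  have e : ∫ y, h y ∂μ - ∫ y, h y ∂μ' =
      ∫ z, (∫ y, v y ∂(Q z) - ∫ y, v y ∂(Q' z)) ∂μ := by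
    rw [integral_sub hinv.1 hi', hinv.2]
    simp_rw [hQ']
    have hs : Integrable (fun z => h z - ∫ y, h y ∂μ') μ := hhμ.sub (integrable_const _)
    rw [integral_sub hvμ hs, integral_sub hhμ (integrable_const _)]
    simp
  rw [e]
  exact (abs_integral_le_mul H.integrable (hD v _ hvm hvc)).trans
    (mul_le_mul_of_nonneg_left hB (mul_nonneg (mul_nonneg hc0 hS) hD0))

lemma abs_mean_sub_mean_le (H : IsGeomErgodic V Q μ C ρ) (H' : IsGeomErgodic V Q' μ' C ρ)
    {D B l : ℝ} (hD0 : 0 ≤ D)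
    (hD : ∀ (h : Z → ℝ) (c : ℝ), Measurable h → (∀ y, |h y| ≤ c * V y) →
      ∀ z, |∫ y, h y ∂(Q z) - ∫ y, h y ∂(Q' z)| ≤ c * D * V z)
    (hB : ∫ y, V y ∂μ ≤ B) {h h' : Z → ℝ} {c : ℝ} (hc0 : 0 ≤ c) (hl0 : 0 ≤ l)
    (hm : Measurable h) (hc : ∀ y, |h y| ≤ c * V y) (hm' : Measurable h')
    (hc' : ∀ y, |h' y| ≤ c * V y) (hl : ∀ y, |h y - h' y| ≤ l * V y) :
    |∫ y, h y ∂μ - ∫ y, h' y ∂μ'| ≤ l * B + c * (C * (1 - ρ)⁻¹) * D * B := by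
  have h1 := H.abs_integral_sub_integral_le H' hD0 hD hB hc0 hm' hc'
  have h2 := abs_integral_le_mul H.integrable hl
  rw [integral_sub (integrable_of_abs_le_mul H.integrable hm hc)
    (integrable_of_abs_le_mul H.integrable hm' hc')] at h2
  have h3 := mul_le_mul_of_nonneg_left hB hl0
  have h4 := abs_add_le (∫ y, h y ∂μ - ∫ y, h' y ∂μ) (∫ y, h' y ∂μ - ∫ y, h' y ∂μ')
  rw [sub_add_sub_cancel] at h4
  linarith

/-- Lipschitz dependence of the Poisson solution on the kernel and on the right-hand side. -/
lemma abs_poisson_sub_poisson_le (H : IsGeomErgodic V Q μ C ρ) (H' : IsGeomErgodic V Q' μ' C ρ)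
    {D B l : ℝ} (hD0 : 0 ≤ D)
    (hD : ∀ (h : Z → ℝ) (c : ℝ), Measurable h → (∀ y, |h y| ≤ c * V y) →
      ∀ z, |∫ y, h y ∂(Q z) - ∫ y, h y ∂(Q' z)| ≤ c * D * V z)
    (hB : ∫ y, V y ∂μ ≤ B) {h h' : Z → ℝ} {c : ℝ} (hc0 : 0 ≤ c) (hl0 : 0 ≤ l)
    (hm : Measurable h) (hc : ∀ y, |h y| ≤ c * V y) (hm' : Measurable h')
    (hc' : ∀ y, |h' y| ≤ c * V y) (hl : ∀ y, |h y - h' y| ≤ l * V y) (z : Z) :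
    |poisson Q μ h z - poisson Q' μ' h' z| ≤
      ((l + (l * B + c * (C * (1 - ρ)⁻¹) * D * B) + c * (C * (1 - ρ)⁻¹) * D) * (C * (1 - ρ)⁻¹)
        + c * (C * (1 - ρ)⁻¹) * (C * (1 - ρ)⁻¹) * D * B) * V z := by
  have := H.isProb
  have hS : 0 ≤ C * (1 - ρ)⁻¹ := mul_nonneg H.const_nonneg
    (inv_nonneg.2 (by linarith [H.rate_lt_one]))
  set S := C * (1 - ρ)⁻¹ with hSdef
  set u := poisson Q μ h with hu
  set v := poisson Q' μ' h' with hv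
  have hum : Measurable u := measurable_poisson hm
  have hvm : Measurable v := measurable_poisson hm'
  have huc : ∀ y, |u y| ≤ c * S * V y := H.abs_poisson_le hm hc
  have hvc : ∀ y, |v y| ≤ c * S * V y := H'.abs_poisson_le hm' hc'
  have hmean := H.abs_mean_sub_mean_le H' hD0 hD hB hc0 hl0 hm hc hm' hc' hl
  have hwc : ∀ y, |u y - v y| ≤ (c * S + c * S) * V y := fun y =>
    (abs_sub _ _).trans (by linarith [huc y, hvc y])
  have hV0 : ∀ y, 0 ≤ V y := fun y => (H.weight_pos y).le
  -- The defect of u - v under Q is (h - h') - (μ h - μ' h') + (Q - Q') v; each of the three terms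
  -- is small.
  have hq : ∀ y, |(u y - v y) - ∫ y', (u y' - v y') ∂(Q y)| ≤
      (l + (l * B + c * S * D * B) + c * S * D) * V y := fun y => by
    have hVQ := H.integrable_kernel y
    rw [integral_sub (integrable_of_abs_le_mul hVQ hum huc)
      (integrable_of_abs_le_mul hVQ hvm hvc)]
    have e1 := H.poisson_sub_integral hm hc y
    have e2 := H'.poisson_sub_integral hm' hc' y
    rw [← hu] at e1
    rw [← hv] at e2
    have e3 := hD v _ hvm hvc y
    have e : (u y - v y) - (∫ y', u y' ∂(Q y) - ∫ y', v y' ∂(Q y)) =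
        (h y - h' y) - (∫ y, h y ∂μ - ∫ y, h' y ∂μ') +
          (∫ y', v y' ∂(Q y) - ∫ y', v y' ∂(Q' y)) := by linarith
    rw [e]
    have h1 := abs_add_le ((h y - h' y) - (∫ y, h y ∂μ - ∫ y, h' y ∂μ'))
      (∫ y', v y' ∂(Q y) - ∫ y', v y' ∂(Q' y))
    have h2 := abs_sub (h y - h' y) (∫ y, h y ∂μ - ∫ y, h' y ∂μ')
    have h3 := le_mul_of_one_le_right ((abs_nonneg _).trans hmean) (H.one_le y)
    linarith [hl y]
  have h1 := H.abs_sub_integral_le (hum.sub hvm) hwc hq z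
  rw [← hSdef] at h1
  -- Since μ u = 0 and μ' v = 0, the mean of u - v only measures the distance of the invariant laws,
  -- tested on v.
  have h2 : ∫ y, (u y - v y) ∂μ = - (∫ y, v y ∂μ - ∫ y, v y ∂μ') := by
    rw [integral_sub (integrable_of_abs_le_mul H.integrable hum huc)
      (integrable_of_abs_le_mul H.integrable hvm hvc), hu, H.integral_poisson hm hc, hv,
      H'.integral_poisson hm' hc']
    ring
  have h3 := H.abs_integral_sub_integral_le H' hD0 hD hB (mul_nonneg hc0 hS) hvm hvc
  rw [← hSdef] at h3
  have h4 := le_mul_of_one_le_right ((abs_nonneg _).trans h3) (H.one_le z)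
  have h5 := abs_add_le ((u z - v z) - ∫ y, (u y - v y) ∂μ) (∫ y, (u y - v y) ∂μ)
  rw [sub_add_cancel, h2, abs_neg, ← h2] at h5
  simp only [Pi.sub_apply] at h1
  linarith

end IsGeomErgodic

end Perturbation

/-! ### Consequences of the weighted-norm assumptions -/

section Extraction

variable {Z : Type*}

lemma norm_le_of_wNorm_le {G : Type*} [NormedAddCommGroup G] {V : Z → ℝ} (hV : ∀ z, 1 ≤ V z)
    {h : Z → G} {c : ℝ} (hc : 0 ≤ c) (hh : wNorm V h ≤ ENNReal.ofReal c) (z : Z) :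
    ‖h z‖ ≤ c * V z := by
  have hVz : 0 < V z := by linarith [hV z]
  have h1 : ‖h z‖ₑ / ENNReal.ofReal (V z) ≤ ENNReal.ofReal c :=
    (le_iSup (fun z => ‖h z‖ₑ / ENNReal.ofReal (V z)) z).trans hh
  rw [ENNReal.div_le_iff (by simpa using hVz) ENNReal.ofReal_ne_top, ← ENNReal.ofReal_mul hc,
    ← ofReal_norm] at h1
  exact (ENNReal.ofReal_le_ofReal_iff (mul_nonneg hc hVz.le)).1 h1

lemma wNorm_le_one {V h : Z → ℝ} (hV : ∀ z, 1 ≤ V z) (hh : ∀ z, |h z| ≤ V z) : wNorm V h ≤ 1 := by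
  refine iSup_le fun z => ?_
  have hVz : 0 < V z := by linarith [hV z]
  rw [ENNReal.div_le_iff (by simpa using hVz) ENNReal.ofReal_ne_top, one_mul,
    ← ofReal_norm]
  exact ENNReal.ofReal_le_ofReal (hh z)

variable [MeasurableSpace Z]

/-- `ENNReal.ofReal` loses negative values, so the variation controls one sign at a time; the other
sign comes from -φ. -/
lemma abs_integral_sub_le_of_wVariation_le {V : Z → ℝ} (hV : ∀ z, 1 ≤ V z) {μ ν : Measure Z}
    {r : ℝ} (hr : 0 ≤ r) (h : wVariation V μ ν ≤ ENNReal.ofReal r) {φ : Z → ℝ}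
    (hm : Measurable φ) (hφ : ∀ z, |φ z| ≤ V z) (hμ : Integrable φ μ) (hν : Integrable φ ν) :
    |∫ z, φ z ∂μ - ∫ z, φ z ∂ν| ≤ r := by
  have key : ∀ ψ : Z → ℝ, Measurable ψ → (∀ z, |ψ z| ≤ V z) → Integrable ψ μ → Integrable ψ ν →
      ∫ z, ψ z ∂μ - ∫ z, ψ z ∂ν ≤ r := fun ψ hψ hψV h1 h2 => by
    have : ENNReal.ofReal (∫ z, ψ z ∂μ - ∫ z, ψ z ∂ν) ≤ wVariation V μ ν :=
      le_iSup_of_le ψ <| le_iSup_of_le hψ <| le_iSup_of_le (wNorm_le_one hV hψV) <|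
        le_iSup_of_le h1 <| le_iSup_of_le h2 le_rfl
    exact (ENNReal.ofReal_le_ofReal_iff hr).1 (this.trans h)
  refine abs_le.2 ⟨?_, key φ hm hφ hμ hν⟩
  have := key (fun z => -φ z) hm.neg (fun z => by simpa using hφ z) hμ.neg hν.neg
  rw [integral_neg, integral_neg] at this
  linarith

/-- A weight is integrable as soon as its truncations have bounded integrals. -/
lemma integrable_of_integral_min_le {V : Z → ℝ} (hm : Measurable V) (hV : ∀ z, 1 ≤ V z)
    {μ : Measure Z} [IsProbabilityMeasure μ] {B : ℝ}
    (hB : ∀ n : ℕ, ∫ z, min (V z) n ∂μ ≤ B) : Integrable V μ ∧ ∫ z, V z ∂μ ≤ B := by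
  have h0 : ∀ (n : ℕ) z, 0 ≤ min (V z) n := fun n z => le_min (by linarith [hV z]) n.cast_nonneg
  have hi : ∀ n : ℕ, Integrable (fun z => min (V z) (n : ℝ)) μ := fun n =>
    Integrable.of_bound (hm.min measurable_const).aestronglyMeasurable n (ae_of_all _ fun z => by
      rw [Real.norm_of_nonneg (h0 n z)]; exact min_le_right _ _)
  have hlim : ∫⁻ z, ENNReal.ofReal (V z) ∂μ ≤ ENNReal.ofReal B := by
    have e : ∀ z, ENNReal.ofReal (V z) = ⨆ n : ℕ, ENNReal.ofReal (min (V z) n) := fun z => by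
      refine le_antisymm ?_ (iSup_le fun n => ENNReal.ofReal_le_ofReal (min_le_left _ _))
      obtain ⟨n, hn⟩ := exists_nat_ge (V z)
      exact le_iSup_of_le n (by rw [min_eq_left hn])
    simp_rw [e]
    rw [lintegral_iSup (fun n => (hm.min measurable_const).ennreal_ofReal)]
    · refine iSup_le fun n => ?_
      rw [← ofReal_integral_eq_lintegral_ofReal (hi n) (ae_of_all _ (h0 n))]
      exact ENNReal.ofReal_le_ofReal (hB n)
    · intro a b hab z
      exact ENNReal.ofReal_le_ofReal (min_le_min le_rfl (by exact_mod_cast hab))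
  have hVi : Integrable V μ := by
    refine ⟨hm.aestronglyMeasurable, ?_⟩
    rw [hasFiniteIntegral_iff_ofReal (ae_of_all _ fun z => by simpa using zero_le_one.trans (hV z))]
    exact hlim.trans_lt ENNReal.ofReal_lt_top
  refine ⟨hVi, ?_⟩
  have hB0 : 0 ≤ B := (integral_nonneg (h0 0)).trans (hB 0)
  rw [← ofReal_integral_eq_lintegral_ofReal hVi
    (ae_of_all _ fun z => by simpa using zero_le_one.trans (hV z))] at hlim
  exact (ENNReal.ofReal_le_ofReal_iff hB0).1 hlim

/-- Only finiteness matters here: it makes every function dominated by W integrable under all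
iterates of the kernel. -/
lemma lintegral_pow_lt_top {W : Z → ℝ} (hW : Measurable W) {Q : Kernel Z Z} [IsMarkovKernel Q]
    {lam b : ℝ} (h0 : 0 ≤ lam)
    (hdrift : ∀ z, ∫⁻ y, ENNReal.ofReal (W y) ∂(Q z) ≤ ENNReal.ofReal (lam * W z + b)) (n : ℕ)
    (z : Z) : ∫⁻ y, ENNReal.ofReal (W y) ∂((Q ^ n) z) < ⊤ := by
  induction n generalizing z with
  | zero =>
    rw [pow_zero, show (1 : Kernel Z Z) = Kernel.id from rfl, Kernel.id_apply,
      lintegral_dirac' _ hW.ennreal_ofReal]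
    exact ENNReal.ofReal_lt_top
  | succ n ih =>
    have := isMarkovKernel_pow Q n
    have e : Q ^ (n + 1) = Q ∘ₖ (Q ^ n) := pow_succ' Q n
    rw [e, Kernel.lintegral_comp _ _ _ hW.ennreal_ofReal]
    calc ∫⁻ y, ∫⁻ y', ENNReal.ofReal (W y') ∂(Q y) ∂((Q ^ n) z)
        ≤ ∫⁻ y, (ENNReal.ofReal lam * ENNReal.ofReal (W y) + ENNReal.ofReal b) ∂((Q ^ n) z) := by
          refine lintegral_mono fun y => (hdrift y).trans ?_
          rw [← ENNReal.ofReal_mul h0]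
          exact ENNReal.ofReal_add_le
      _ = ENNReal.ofReal lam * ∫⁻ y, ENNReal.ofReal (W y) ∂((Q ^ n) z) + ENNReal.ofReal b := by
          rw [lintegral_add_right _ measurable_const, lintegral_const_mul _ hW.ennreal_ofReal]
          simp
      _ < ⊤ := ENNReal.add_lt_top.2 ⟨ENNReal.mul_lt_top ENNReal.ofReal_lt_top (ih z),
          ENNReal.ofReal_lt_top⟩

variable {E : Type*} [NormedAddCommGroup E]

/-- Uniform ergodicity yields, for the weight `W ^ (1/2)`, common constants and a common bound on
the integral of the weight under the invariant laws. -/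
lemma UniformlyErgodic.exists_isGeomErgodic {K : Set E} {Φ : E → Z → E} {M : E → Kernel Z Z}
    {π : E → Measure Z} {W : Z → ℝ} (h : UniformlyErgodic K Φ M π W)
    (hM : ∀ x ∈ K, IsMarkovKernel (M x)) (hπ : ∀ x ∈ K, IsProbabilityMeasure (π x))
    (hMπ : ∀ x ∈ K, Kernel.Invariant (M x) (π x)) :
    ∃ C ρ B : ℝ, 0 ≤ B ∧ ∀ x ∈ K,
      IsGeomErgodic (fun z => W z ^ (1 / 2 : ℝ)) (M x) (π x) C ρ ∧
        ∫ z, W z ^ (1 / 2 : ℝ) ∂(π x) ≤ B := by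
  rcases K.eq_empty_or_nonempty with rfl | ⟨x₀, hx₀⟩
  · exact ⟨0, 0, 0, le_rfl, by simp⟩
  have := hπ x₀ hx₀
  obtain ⟨z₀⟩ : Nonempty Z := nonempty_of_isProbabilityMeasure (π x₀)
  obtain ⟨C, ρ, hρ0, hρ1, hC⟩ := h.ergodic (1 / 2) (by norm_num) (by norm_num)
  obtain ⟨lam, b, hlam0, -, hdrift⟩ := h.drift
  set V : Z → ℝ := fun z => W z ^ (1 / 2 : ℝ) with hVdef
  have hVm : Measurable V := h.measurable_weight.pow_const _
  have hV1 : ∀ z, 1 ≤ V z := fun z => Real.one_le_rpow (h.one_le_weight z) (by norm_num)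
  have hV0 : ∀ z, 0 ≤ V z := fun z => zero_le_one.trans (hV1 z)
  have hVW : ∀ z, V z ≤ W z := fun z =>
    Real.rpow_le_self_of_one_le (h.one_le_weight z) (by norm_num)
  have hC0 : 0 ≤ max C 0 := le_max_right _ _
  have hvar : ∀ x ∈ K, ∀ (n : ℕ) (z : Z), wVariation V ((M x ^ n) z) (π x) ≤
      ENNReal.ofReal (max C 0 * ρ ^ n * V z) := fun x hx n z =>
    ((le_iSup₂ (f := fun x _ => wVariation V ((M x ^ n) z) (π x)) x hx).trans (hC n z)).trans
      (ENNReal.ofReal_le_ofReal (mul_le_mul_of_nonneg_right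
        (mul_le_mul_of_nonneg_right (le_max_left _ _) (pow_nonneg hρ0.le _)) (hV0 z)))
  have hr0 : ∀ (n : ℕ) (z : Z), 0 ≤ max C 0 * ρ ^ n * V z := fun n z =>
    mul_nonneg (mul_nonneg hC0 (pow_nonneg hρ0.le _)) (hV0 z)
  refine ⟨max C 0, ρ, V z₀ + max C 0 * V z₀, add_nonneg (hV0 _) (mul_nonneg hC0 (hV0 _)),
    fun x hx => ?_⟩
  have := hM x hx
  have := hπ x hx
  have hVpow : ∀ n z, Integrable V ((M x ^ n) z) := fun n z => by
    refine ⟨hVm.aestronglyMeasurable, ?_⟩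
    rw [hasFiniteIntegral_iff_ofReal (ae_of_all _ hV0)]
    exact (lintegral_mono fun y => ENNReal.ofReal_le_ofReal (hVW y)).trans_lt
      (lintegral_pow_lt_top h.measurable_weight hlam0 (fun z =>
        (le_iSup₂ (f := fun x _ => ∫⁻ y, ENNReal.ofReal (W y) ∂(M x z)) x hx).trans (hdrift z)) n z)
  -- The variation tests only functions integrable for both laws, so V itself is not yet admissible.
  -- Its truncations are, and ergodicity at n = 0, where the iterate is the Dirac mass at z₀, bounds
  -- their means independently of x.
  have hVπ := integrable_of_integral_min_le (μ := π x) hVm hV1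
    (B := V z₀ + max C 0 * V z₀) (fun n => by
      have hmin0 : ∀ z, 0 ≤ min (V z) (n : ℝ) := fun z => le_min (hV0 z) n.cast_nonneg
      have hminm : Measurable fun z => min (V z) (n : ℝ) := hVm.min measurable_const
      have hib : ∀ ν : Measure Z, IsFiniteMeasure ν → Integrable (fun z => min (V z) (n : ℝ)) ν :=
        fun ν _ => Integrable.of_bound hminm.aestronglyMeasurable n (ae_of_all _ fun z => by
          rw [Real.norm_of_nonneg (hmin0 z)]; exact min_le_right _ _)
      have e : (M x ^ 0) z₀ = Measure.dirac z₀ := by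
        rw [pow_zero, show (1 : Kernel Z Z) = Kernel.id from rfl, Kernel.id_apply]
      have h1 := abs_integral_sub_le_of_wVariation_le hV1 (hr0 0 z₀) (hvar x hx 0 z₀) hminm
        (fun z => by rw [abs_of_nonneg (hmin0 z)]; exact min_le_left _ _)
        (by rw [e]; exact hib _ inferInstance) (hib _ inferInstance)
      rw [e, integral_dirac' _ _ hminm.stronglyMeasurable, pow_zero, mul_one] at h1
      have := (abs_le.1 h1).1
      linarith [min_le_left (V z₀) (n : ℝ)])
  refine ⟨⟨hVm, hV1, hM x hx, hπ x hx, hMπ x hx, hC0, hρ0.le, hρ1, hVpow, hVπ.1,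
    fun n z φ hφ hφV => ?_⟩, hVπ.2⟩
  have hφV' : ∀ y, |φ y| ≤ 1 * V y := by simpa using hφV
  exact abs_integral_sub_le_of_wVariation_le hV1 (hr0 n z) (hvar x hx n z) hφ hφV
    (integrable_of_abs_le_mul (hVpow n z) hφ hφV') (integrable_of_abs_le_mul hVπ.1 hφ hφV')

/-- Each summand of the hypothesis is bounded by the sum. Integrability of the weight is asked
because the variation tests only integrable functions. -/
lemma LipschitzInParameter.exists_const {K : Set E} {Φ : E → Z → E} {M : E → Kernel Z Z}
    {W : Z → ℝ} (h : LipschitzInParameter K Φ M W) (hW : ∀ z, 1 ≤ W z) :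
    ∃ L : ℝ, 0 ≤ L ∧ ∀ x ∈ K, ∀ x' ∈ K,
      (∀ z, ‖Φ x z - Φ x' z‖ ≤ L * ‖x - x'‖ * W z ^ (1 / 2 : ℝ)) ∧
      ∀ (φ : Z → ℝ) (c : ℝ), Measurable φ → (∀ y, |φ y| ≤ c * W y ^ (1 / 2 : ℝ)) →
        ∀ z, Integrable (fun y => W y ^ (1 / 2 : ℝ)) (M x z) →
          Integrable (fun y => W y ^ (1 / 2 : ℝ)) (M x' z) →
          |∫ y, φ y ∂(M x z) - ∫ y, φ y ∂(M x' z)| ≤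
            c * (L * ‖x - x'‖) * W z ^ (1 / 2 : ℝ) := by
  obtain ⟨C, hC⟩ := h
  have hV1 : ∀ z, 1 ≤ W z ^ (1 / 2 : ℝ) := fun z => Real.one_le_rpow (hW z) (by norm_num)
  refine ⟨max C 0, le_max_right _ _, fun x hx x' hx' => ?_⟩
  have hr : 0 ≤ max C 0 * ‖x - x'‖ := mul_nonneg (le_max_right _ _) (norm_nonneg _)
  have hle := (hC x hx x' hx').trans (ENNReal.ofReal_le_ofReal
    (mul_le_mul_of_nonneg_right (le_max_left C 0) (norm_nonneg (x - x'))))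
  refine ⟨norm_le_of_wNorm_le hV1 hr (le_self_add.trans hle), fun φ c hφ hφV z hi hi' => ?_⟩
  have hVz : 0 < W z ^ (1 / 2 : ℝ) := by linarith [hV1 z]
  have hvar : wVariation (fun y => W y ^ (1 / 2 : ℝ)) (M x z) (M x' z) ≤
      ENNReal.ofReal (max C 0 * ‖x - x'‖ * W z ^ (1 / 2 : ℝ)) := by
    rw [ENNReal.ofReal_mul hr, ← ENNReal.div_le_iff (by simpa using hVz) ENNReal.ofReal_ne_top]
    exact (le_iSup (fun z => wVariation (fun y => W y ^ (1 / 2 : ℝ)) (M x z) (M x' z) /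
      ENNReal.ofReal (W z ^ (1 / 2 : ℝ))) z).trans (le_add_self.trans hle)
  have hc0 : 0 ≤ c := nonneg_of_mul_nonneg_left ((abs_nonneg _).trans (hφV z)) hVz
  rcases hc0.eq_or_lt with rfl | hc0
  · have : φ = fun _ => 0 := by
      ext y; simpa using hφV y
    simp [this]
  · have h1 := abs_integral_sub_le_of_wVariation_le hV1 (mul_nonneg hr hVz.le) hvar
      (hφ.const_mul c⁻¹) (fun y => by
        rw [abs_mul, abs_of_pos (inv_pos.2 hc0), inv_mul_le_iff₀ hc0]; exact hφV y)
      ((integrable_of_abs_le_mul hi hφ hφV).const_mul _)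
      ((integrable_of_abs_le_mul hi' hφ hφV).const_mul _)
    rw [integral_const_mul, integral_const_mul, ← mul_sub, abs_mul, abs_of_pos (inv_pos.2 hc0),
      inv_mul_le_iff₀ hc0] at h1
    linarith

/-- Poisson solutions `G x` for the family of kernels `M x`, `x ∈ K`, and right-hand sides `h x`,
together with their images `u x` under the kernels, with uniform bounds and Lipschitz constants. -/
lemma exists_poisson_family {K : Set E} {V : Z → ℝ} {M : E → Kernel Z Z} {π : E → Measure Z}
    {C ρ B L c : ℝ} (hB : 0 ≤ B) (hL : 0 ≤ L) (hc : 0 ≤ c)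
    (H : ∀ x ∈ K, IsGeomErgodic V (M x) (π x) C ρ) (hπB : ∀ x ∈ K, ∫ z, V z ∂(π x) ≤ B)
    (hD : ∀ x ∈ K, ∀ x' ∈ K, ∀ (φ : Z → ℝ) (c : ℝ), Measurable φ → (∀ y, |φ y| ≤ c * V y) →
      ∀ z, |∫ y, φ y ∂(M x z) - ∫ y, φ y ∂(M x' z)| ≤ c * (L * ‖x - x'‖) * V z)
    {h : E → Z → ℝ} (hm : ∀ x ∈ K, Measurable (h x)) (hhc : ∀ x ∈ K, ∀ z, |h x z| ≤ c * V z)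
    (hhL : ∀ x ∈ K, ∀ x' ∈ K, ∀ z, |h x z - h x' z| ≤ L * ‖x - x'‖ * V z) :
    ∃ (G u : E → Z → ℝ) (c' L' : ℝ), 0 ≤ c' ∧ 0 ≤ L' ∧
      (∀ x ∈ K, Measurable (G x)) ∧ (∀ x ∈ K, Measurable (u x)) ∧
      (∀ x ∈ K, ∀ z, |G x z| ≤ c' * V z) ∧ (∀ x ∈ K, ∀ z, |u x z| ≤ c' * V z) ∧
      (∀ x ∈ K, ∀ x' ∈ K, ∀ z, |G x z - G x' z| ≤ L' * ‖x - x'‖ * V z) ∧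
      (∀ x ∈ K, ∀ x' ∈ K, ∀ z, |u x z - u x' z| ≤ L' * ‖x - x'‖ * V z) ∧
      (∀ x ∈ K, ∀ z, u x z = ∫ y, G x y ∂(M x z)) ∧
      ∀ x ∈ K, ∀ z, G x z - u x z = h x z - ∫ y, h x y ∂(π x) := by
  rcases K.eq_empty_or_nonempty with rfl | ⟨x₀, hx₀⟩
  · exact ⟨0, 0, 0, 0, le_rfl, le_rfl, by simp⟩
  set S := C * (1 - ρ)⁻¹ with hSdef
  have hS : 0 ≤ S := mul_nonneg (H x₀ hx₀).const_nonneg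
    (inv_nonneg.2 (by linarith [(H x₀ hx₀).rate_lt_one]))
  -- The bound of `abs_poisson_sub_poisson_le` is linear in (D, l); with D = l = L ‖x - x'‖ a factor
  -- ‖x - x'‖ comes out and A remains.
  set A := (L + (L * B + c * S * L * B) + c * S * L) * S + c * S * S * L * B with hA
  have hA0 : 0 ≤ A := by positivity
  have hGL : ∀ x ∈ K, ∀ x' ∈ K, ∀ z,
      |poisson (M x) (π x) (h x) z - poisson (M x') (π x') (h x') z| ≤ A * ‖x - x'‖ * V z := by
    intro x hx x' hx' z
    have := (H x hx).abs_poisson_sub_poisson_le (H x' hx') (mul_nonneg hL (norm_nonneg (x - x')))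
      (hD x hx x' hx') (hπB x hx) hc (mul_nonneg hL (norm_nonneg (x - x'))) (hm x hx) (hhc x hx)
      (hm x' hx') (hhc x' hx') (hhL x hx x' hx') z
    refine this.trans_eq ?_
    rw [hA]; ring
  have hmL : ∀ x ∈ K, ∀ x' ∈ K, |∫ y, h x y ∂(π x) - ∫ y, h x' y ∂(π x')| ≤
      (L * B + c * S * L * B) * ‖x - x'‖ := by
    intro x hx x' hx'
    have := (H x hx).abs_mean_sub_mean_le (H x' hx') (mul_nonneg hL (norm_nonneg (x - x')))
      (hD x hx x' hx') (hπB x hx) hc (mul_nonneg hL (norm_nonneg (x - x'))) (hm x hx) (hhc x hx)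
      (hm x' hx') (hhc x' hx') (hhL x hx x' hx')
    refine this.trans_eq ?_
    ring
  have hGc : ∀ x ∈ K, ∀ z, |poisson (M x) (π x) (h x) z| ≤ c * S * V z := fun x hx =>
    (H x hx).abs_poisson_le (hm x hx) (hhc x hx)
  have hmc : ∀ x ∈ K, |∫ y, h x y ∂(π x)| ≤ c * B := fun x hx =>
    (abs_integral_le_mul (H x hx).integrable (hhc x hx)).trans
      (mul_le_mul_of_nonneg_left (hπB x hx) hc)
  -- Defining u as G - (h - π h), not as M G, lets it inherit measurability and Lipschitz bounds
  -- from G, h and the means; u = M G is then the Poisson equation.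
  refine ⟨fun x => poisson (M x) (π x) (h x),
    fun x z => poisson (M x) (π x) (h x) z - (h x z - ∫ y, h x y ∂(π x)),
    c * S + c + c * B, A + L + (L * B + c * S * L * B), by positivity, by positivity,
    fun x hx => IsGeomErgodic.measurable_poisson (hm x hx),
    fun x hx => (IsGeomErgodic.measurable_poisson (hm x hx)).sub ((hm x hx).sub_const _),
    fun x hx z => ?_, fun x hx z => ?_, fun x hx x' hx' z => ?_, fun x hx x' hx' z => ?_,
    fun x hx z => ?_, fun x hx z => by ring⟩
  · have hV := (H x hx).weight_pos z
    refine (hGc x hx z).trans (mul_le_mul_of_nonneg_right ?_ hV.le)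
    nlinarith
  · have h1 := (hmc x hx).trans (le_mul_of_one_le_right (mul_nonneg hc hB) ((H x hx).one_le z))
    have h2 := abs_sub (poisson (M x) (π x) (h x) z) (h x z - ∫ y, h x y ∂(π x))
    have h3 := abs_sub (h x z) (∫ y, h x y ∂(π x))
    linarith [hGc x hx z, hhc x hx z]
  · refine (hGL x hx x' hx' z).trans (mul_le_mul_of_nonneg_right
      (mul_le_mul_of_nonneg_right ?_ (norm_nonneg _)) ((H x hx).weight_pos z).le)
    have : 0 ≤ L * B + c * S * L * B := by positivity
    linarith
  · have h1 := (hmL x hx x' hx').trans (le_mul_of_one_le_right (by positivity) ((H x hx).one_le z))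
    have h2 := abs_sub (poisson (M x) (π x) (h x) z - poisson (M x') (π x') (h x') z)
      ((h x z - h x' z) - (∫ y, h x y ∂(π x) - ∫ y, h x' y ∂(π x')))
    have h3 := abs_sub (h x z - h x' z) (∫ y, h x y ∂(π x) - ∫ y, h x' y ∂(π x'))
    have h4 := hGL x hx x' hx' z
    have h5 := hhL x hx x' hx' z
    calc _ = |poisson (M x) (π x) (h x) z - poisson (M x') (π x') (h x') z -
      ((h x z - h x' z) - (∫ y, h x y ∂(π x) - ∫ y, h x' y ∂(π x')))| := by congr 1; ring
      _ ≤ _ := by linarith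
  · have := (H x hx).poisson_sub_integral (hm x hx) (hhc x hx) z
    linarith

end Extraction

/-! ### Conditional laws given by a kernel -/

section ConditionalLaw

variable {Ω S Z : Type*} {m m0 : MeasurableSpace Ω} [MeasurableSpace S] [MeasurableSpace Z]
  {P : Measure[m0] Ω} [IsProbabilityMeasure P] {p : Ω → S} {Y : Ω → Z} {κ : Kernel S Z}
  [IsMarkovKernel κ]

/-- Rectangles A × B determine the finite measure, and on them the claim is the defining property of
the conditional probability of {Y ∈ B}, integrated over the past event s ∩ {p ∈ A}. The free event s
is what later identifies conditional expectations. -/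
lemma map_restrict_eq_compProd (hm : m ≤ m0) (hp : Measurable[m] p) (hY : Measurable[m0] Y)
    (hκ : ∀ A, MeasurableSet A → P⟦Y ⁻¹' A|m⟧ =ᵐ[P] fun ω => (κ (p ω)).real A)
    {s : Set Ω} (hs : MeasurableSet[m] s) :
    (P.restrict s).map (fun ω => (p ω, Y ω)) = ((P.restrict s).map p) ⊗ₘ κ := by
  have hp0 : Measurable[m0] p := hp.mono hm le_rfl
  have hprod : Measurable[m0] fun ω => (p ω, Y ω) := hp0.prodMk hY
  have : IsFiniteMeasure ((P.restrict s).map fun ω => (p ω, Y ω)) :=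
    Measure.isFiniteMeasure_map _ _
  refine Measure.ext_prod fun {A B} hA hB => ?_
  have ht : MeasurableSet[m] (p ⁻¹' A ∩ s) := (hp hA).inter hs
  have hκm : Measurable fun a => κ a B := Kernel.measurable_coe κ hB
  have hreal : Measurable[m0] fun ω => (κ (p ω)).real B := (hκm.comp hp0).ennreal_toReal
  rw [Measure.compProd_apply_prod hA hB, Measure.map_apply hprod (hA.prod hB),
    setLIntegral_map hA hκm hp0, Measure.restrict_restrict (hp0 hA),
    Measure.restrict_apply (hprod (hA.prod hB))]
  have h1 : ∫ ω in p ⁻¹' A ∩ s, (Y ⁻¹' B).indicator (fun _ => (1 : ℝ)) ω ∂P =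
      ∫ ω in p ⁻¹' A ∩ s, (κ (p ω)).real B ∂P := by
    rw [← setIntegral_condExp hm ((integrable_const (1 : ℝ)).indicator (hY hB)) ht]
    exact setIntegral_congr_ae (hm _ ht) ((hκ B hB).mono fun ω h _ => h)
  have h2 : ∫⁻ ω in p ⁻¹' A ∩ s, κ (p ω) B ∂P =
      ENNReal.ofReal (∫ ω in p ⁻¹' A ∩ s, (κ (p ω)).real B ∂P) := by
    rw [ofReal_integral_eq_lintegral_ofReal]
    · simp
    · exact Integrable.of_bound hreal.aestronglyMeasurable 1 (ae_of_all _ fun ω => by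
        rw [Real.norm_of_nonneg measureReal_nonneg]; exact measureReal_le_one)
    · exact ae_of_all _ fun ω => measureReal_nonneg
  rw [h2, ← h1, setIntegral_indicator (hY hB)]
  simp only [integral_const, smul_eq_mul, mul_one, measureReal_restrict_apply_univ]
  rw [ofReal_measureReal]
  congr 1
  ext ω
  simp only [mem_inter_iff, mem_preimage, mem_prod]
  tauto

lemma lintegral_eq_lintegral_lintegral_kernel (hm : m ≤ m0) (hp : Measurable[m] p)
    (hY : Measurable[m0] Y)
    (hκ : ∀ A, MeasurableSet A → P⟦Y ⁻¹' A|m⟧ =ᵐ[P] fun ω => (κ (p ω)).real A)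
    {F : Z → ℝ≥0∞} (hF : Measurable F) :
    ∫⁻ ω, F (Y ω) ∂P = ∫⁻ ω, ∫⁻ y, F y ∂(κ (p ω)) ∂P := by
  have hp0 : Measurable[m0] p := hp.mono hm le_rfl
  have h := map_restrict_eq_compProd hm hp hY hκ MeasurableSet.univ
  rw [Measure.restrict_univ] at h
  have hF' : Measurable fun q : S × Z => F q.2 := hF.comp measurable_snd
  have h1 : ∫⁻ q, F q.2 ∂(P.map fun ω => (p ω, Y ω)) = ∫⁻ q, F q.2 ∂(P.map p ⊗ₘ κ) := by rw [h]
  rw [lintegral_map hF' (hp0.prodMk hY), Measure.lintegral_compProd hF',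
    lintegral_map (Measurable.lintegral_kernel hF) hp0] at h1
  exact h1

/-- The conditional expectation of a function of the past and of the new sample. -/
lemma condExp_eq_integral_kernel (hm : m ≤ m0) (hp : Measurable[m] p) (hY : Measurable[m0] Y)
    (hκ : ∀ A, MeasurableSet A → P⟦Y ⁻¹' A|m⟧ =ᵐ[P] fun ω => (κ (p ω)).real A)
    {F : S × Z → ℝ} (hF : Measurable F) (hint : Integrable (fun ω => F (p ω, Y ω)) P) :
    (fun ω => ∫ y, F (p ω, y) ∂(κ (p ω))) =ᵐ[P] P[fun ω => F (p ω, Y ω)|m] := by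
  have hp0 : Measurable[m0] p := hp.mono hm le_rfl
  have hprod : Measurable[m0] fun ω => (p ω, Y ω) := hp0.prodMk hY
  have hIm : Measurable fun a => ∫ y, F (a, y) ∂(κ a) :=
    hF.stronglyMeasurable.integral_kernel_prod_right'.measurable
  have hFs : ∀ s, MeasurableSet[m] s → Integrable F (((P.restrict s).map p) ⊗ₘ κ) := fun s hs => by
    rw [← map_restrict_eq_compProd hm hp hY hκ hs,
      integrable_map_measure hF.aestronglyMeasurable hprod.aemeasurable]
    exact hint.restrict
  refine ae_eq_condExp_of_forall_setIntegral_eq hm hint (fun s hs _ => ?_) (fun s hs _ => ?_)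
    (hIm.comp hp).aestronglyMeasurable
  · have h1 : Integrable (fun a => ∫ y, F (a, y) ∂(κ a)) ((P.restrict s).map p) :=
      by simpa using Integrable.integral_compProd (hFs s hs)
    exact (integrable_map_measure hIm.aestronglyMeasurable hp0.aemeasurable).1 h1
  · have h1 := Measure.integral_compProd (hFs s hs)
    rw [← map_restrict_eq_compProd hm hp hY hκ hs,
      integral_map hprod.aemeasurable hF.aestronglyMeasurable,
      integral_map hp0.aemeasurable hIm.aestronglyMeasurable] at h1
    exact h1.symm

end ConditionalLaw

/-! ### Almost sure convergence of series -/

section Convergence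

variable {Ω : Type*} {m0 : MeasurableSpace Ω} {P : Measure Ω}

/-- By Tonelli the expectation of the sum is at most R ∑ a n, so the sum is almost surely finite. -/
lemma ae_summable_mul {a : ℕ → ℝ} (ha : ∀ n, 0 ≤ a n) (hs : Summable a) {Y : ℕ → Ω → ℝ}
    (hY0 : ∀ n ω, 0 ≤ Y n ω) (hY : ∀ n, Measurable (Y n)) {R : ℝ}
    (hR : ∀ n, ∫⁻ ω, ENNReal.ofReal (Y n ω) ∂P ≤ ENNReal.ofReal R) :
    ∀ᵐ ω ∂P, Summable fun n => a n * Y n ω := by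
  have hm : ∀ n, Measurable fun ω => ENNReal.ofReal (a n * Y n ω) := fun n =>
    ((hY n).const_mul _).ennreal_ofReal
  have hlt : ∫⁻ ω, ∑' n, ENNReal.ofReal (a n * Y n ω) ∂P ≠ ⊤ := by
    rw [lintegral_tsum fun n => (hm n).aemeasurable]
    refine ne_top_of_le_ne_top (ENNReal.mul_ne_top hs.tsum_ofReal_ne_top
      (ENNReal.ofReal_ne_top (r := R))) ?_
    rw [← ENNReal.tsum_mul_right]
    refine ENNReal.tsum_le_tsum fun n => ?_
    simp_rw [ENNReal.ofReal_mul (ha n)]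
    rw [lintegral_const_mul _ (hY n).ennreal_ofReal]
    gcongr
    exact hR n
  filter_upwards [ae_lt_top (Measurable.tsum hm) hlt] with ω hω
  have := ENNReal.summable_toReal hω.ne
  refine this.congr fun n => ?_
  rw [ENNReal.toReal_ofReal (mul_nonneg (ha n) (hY0 n ω))]

/-- A series of martingale differences with summable second moments converges almost surely. -/
lemma ae_tendsto_sum_of_martingaleDifference [IsProbabilityMeasure P] {ℱ : Filtration ℕ m0}
    {D : ℕ → Ω → ℝ}
    (hD : ∀ n, Measurable[ℱ (n + 1)] (D n)) (hL2 : ∀ n, MemLp (D n) 2 P)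
    (hcond : ∀ n, P[D n|ℱ n] =ᵐ[P] 0) {b : ℕ → ℝ} (hb : Summable b)
    (hDb : ∀ n, ∫ ω, D n ω ^ 2 ∂P ≤ b n) :
    ∀ᵐ ω ∂P, ∃ s, Tendsto (fun n => ∑ k ∈ Finset.range n, D k ω) atTop (𝓝 s) := by
  set S : ℕ → Ω → ℝ := fun n => ∑ k ∈ Finset.range n, D k with hS
  have hSsucc : ∀ n, S (n + 1) = S n + D n := fun n => Finset.sum_range_succ _ _
  have hSm : ∀ n, StronglyMeasurable[ℱ n] (S n) := fun n =>
    Finset.stronglyMeasurable_sum _ fun k hk =>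
      ((hD k).mono (ℱ.mono (Finset.mem_range.1 hk)) le_rfl).stronglyMeasurable
  have hS2 : ∀ n, MemLp (S n) 2 P := fun n => memLp_finsetSum' _ fun k _ => hL2 k
  have hSi : ∀ n, Integrable (S n) P := fun n => (hS2 n).integrable (by norm_num)
  have hDi : ∀ n, Integrable (D n) P := fun n => (hL2 n).integrable (by norm_num)
  have hmart : Martingale S ℱ P := martingale_nat hSm hSi fun n => by
    rw [hSsucc]
    refine EventuallyEq.trans ?_ (condExp_add (hSi n) (hDi n) (ℱ n)).symm
    rw [condExp_of_stronglyMeasurable (ℱ.le n) (hSm n) (hSi n)]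
    filter_upwards [hcond n] with ω hω
    simp [hω]
  have hSD : ∀ n, Integrable (S n * D n) P := fun n => (hS2 n).integrable_mul (hL2 n)
  have horth : ∀ n, ∫ ω, S n ω * D n ω ∂P = 0 := fun n => by
    have h1 := condExp_mul_of_stronglyMeasurable_left (hSm n) (hSD n) (hDi n)
    have h2 := integral_condExp (μ := P) (f := S n * D n) (ℱ.le n)
    rw [integral_congr_ae h1] at h2
    have h3 : ∫ ω, (S n * P[D n|ℱ n]) ω ∂P = 0 := by
      refine integral_eq_zero_of_ae ?_
      filter_upwards [hcond n] with ω hω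
      simp [hω]
    rw [h3] at h2
    exact h2.symm
  -- By orthogonality the second moments of the increments add up.
  have hsq : ∀ n, ∫ ω, S n ω ^ 2 ∂P ≤ ∑ k ∈ Finset.range n, b k := fun n => by
    induction n with
    | zero => simp [hS]
    | succ n ih =>
      have e : ∀ ω, S (n + 1) ω ^ 2 = S n ω ^ 2 + 2 * (S n ω * D n ω) + D n ω ^ 2 := fun ω => by
        rw [hSsucc, Pi.add_apply]; ring
      have i1 : Integrable (fun ω => S n ω ^ 2 + 2 * (S n ω * D n ω)) P :=
        (hS2 n).integrable_sq.add ((hSD n).const_mul 2)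
      have i2 : Integrable (fun ω => 2 * (S n ω * D n ω)) P := (hSD n).const_mul 2
      simp_rw [e]
      rw [integral_add i1 (hL2 n).integrable_sq, integral_add (hS2 n).integrable_sq i2,
        integral_const_mul, horth, Finset.sum_range_succ]
      linarith [hDb n]
  have hb0 : ∀ n, 0 ≤ b n := fun n => (integral_nonneg fun ω => sq_nonneg _).trans (hDb n)
  -- The convergence theorem asks for boundedness in L¹, which follows from |s| ≤ 1 + s².
  have hbdd : ∀ n, eLpNorm (S n) 1 P ≤ (1 + ∑' k, b k).toNNReal := fun n => by
    rw [eLpNorm_one_eq_lintegral_enorm]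
    have i1 : Integrable (fun ω => 1 + S n ω ^ 2) P :=
      (integrable_const 1).add (hS2 n).integrable_sq
    calc ∫⁻ ω, ‖S n ω‖ₑ ∂P ≤ ∫⁻ ω, ENNReal.ofReal (1 + S n ω ^ 2) ∂P := by
          refine lintegral_mono fun ω => ?_
          rw [← ofReal_norm]
          refine ENNReal.ofReal_le_ofReal ?_
          rw [Real.norm_eq_abs]
          nlinarith [sq_abs (S n ω), sq_nonneg (|S n ω| - 1)]
      _ = ENNReal.ofReal (∫ ω, (1 + S n ω ^ 2) ∂P) :=
          (ofReal_integral_eq_lintegral_ofReal i1 (ae_of_all _ fun ω => by positivity)).symm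
      _ ≤ ENNReal.ofReal (1 + ∑' k, b k) := by
          refine ENNReal.ofReal_le_ofReal ?_
          rw [integral_add (integrable_const 1) (hS2 n).integrable_sq]
          have := (hsq n).trans (hb.sum_le_tsum _ fun k _ => hb0 k)
          simpa using this
  filter_upwards [hmart.submartingale.exists_ae_tendsto_of_bdd hbdd] with ω hω
  simpa [hS, Finset.sum_apply] using hω

end Convergence

/-! ### The state-dependent noise -/

section Noise

variable {Ω Z T : Type*} {m0 : MeasurableSpace Ω} {P : Measure Ω} [IsProbabilityMeasure P]
  [MeasurableSpace Z] [MeasurableSpace T] {ℱ : Filtration ℕ m0} {κ : Kernel (T × Z) Z}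
  [IsMarkovKernel κ] {x : ℕ → Ω → T} {z : ℕ → Ω → Z}

/-- A drift condition gives a uniform bound on the moments of the weight along the chain. -/
lemma exists_lintegral_weight_le (hx : ∀ n, Measurable[ℱ n] (x n))
    (hz : ∀ n, Measurable[ℱ n] (z n))
    (htr : ∀ n A, MeasurableSet A →
      P⟦z (n + 1) ⁻¹' A|ℱ n⟧ =ᵐ[P] fun ω => (κ (x n ω, z n ω)).real A)
    {W : Z → ℝ} (hW : Measurable W) (hW0 : ∀ z, 0 ≤ W z) {lam b : ℝ} (h0 : 0 ≤ lam) (h1 : lam < 1)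
    (hdrift : ∀ t z, ∫⁻ y, ENNReal.ofReal (W y) ∂(κ (t, z)) ≤ ENNReal.ofReal (lam * W z + b))
    (hW1 : Integrable (fun ω => W (z 0 ω)) P) :
    ∃ R : ℝ, 0 ≤ R ∧ ∀ n, ∫⁻ ω, ENNReal.ofReal (W (z n ω)) ∂P ≤ ENNReal.ofReal R := by
  set A := ∫ ω, W (z 0 ω) ∂P with hA
  have hA0 : 0 ≤ A := integral_nonneg fun ω => hW0 _
  have hl : 0 < 1 - lam := by linarith
  have hb0 : 0 ≤ max b 0 := le_max_right _ _
  have hR0 : 0 ≤ A + max b 0 / (1 - lam) := by positivity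
  -- The second summand is the fixed point of t ↦ λ t + b⁺, so this R satisfies λ R + b⁺ ≤ R and
  -- propagates by induction.
  refine ⟨A + max b 0 / (1 - lam), hR0, fun n => ?_⟩
  induction n with
  | zero =>
    rw [← ofReal_integral_eq_lintegral_ofReal hW1 (ae_of_all _ fun ω => hW0 _)]
    exact ENNReal.ofReal_le_ofReal (le_add_of_nonneg_right (by positivity))
  | succ n ih =>
    have hzn : Measurable (z n) := (hz n).mono (ℱ.le n) le_rfl
    rw [lintegral_eq_lintegral_lintegral_kernel (ℱ.le n) ((hx n).prodMk (hz n))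
      ((hz (n + 1)).mono (ℱ.le _) le_rfl) (htr n) hW.ennreal_ofReal]
    calc ∫⁻ ω, ∫⁻ y, ENNReal.ofReal (W y) ∂(κ (x n ω, z n ω)) ∂P
        ≤ ∫⁻ ω, (ENNReal.ofReal lam * ENNReal.ofReal (W (z n ω)) +
            ENNReal.ofReal (max b 0)) ∂P := by
          refine lintegral_mono fun ω => (hdrift _ _).trans ?_
          rw [← ENNReal.ofReal_mul h0]
          refine ENNReal.ofReal_add_le.trans ?_
          gcongr
          exact le_max_left _ _
      _ = ENNReal.ofReal lam * ∫⁻ ω, ENNReal.ofReal (W (z n ω)) ∂P + ENNReal.ofReal (max b 0) := by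
          rw [lintegral_add_right _ measurable_const,
            lintegral_const_mul _ (f := fun ω => ENNReal.ofReal (W (z n ω)))
              (hW.comp hzn).ennreal_ofReal]
          simp
      _ ≤ ENNReal.ofReal lam * ENNReal.ofReal (A + max b 0 / (1 - lam)) +
            ENNReal.ofReal (max b 0) := by gcongr
      _ = ENNReal.ofReal (lam * (A + max b 0 / (1 - lam)) + max b 0) := by
          rw [← ENNReal.ofReal_mul h0, ENNReal.ofReal_add (mul_nonneg h0 hR0) hb0]
      _ ≤ _ := by
          refine ENNReal.ofReal_le_ofReal ?_
          have : max b 0 = (1 - lam) * (max b 0 / (1 - lam)) := by field_simp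
          nlinarith

/-- The weighted noise series converges almost surely, by the decomposition into a martingale
difference, a telescoping term, a step-size variation and a parameter variation. -/
lemma ae_tendsto_sum_noise [PseudoMetricSpace T] (hx : ∀ n, Measurable[ℱ n] (x n))
    (hz : ∀ n, Measurable[ℱ n] (z n))
    (htr : ∀ n A, MeasurableSet A →
      P⟦z (n + 1) ⁻¹' A|ℱ n⟧ =ᵐ[P] fun ω => (κ (x n ω, z n ω)).real A)
    {γ : ℕ → ℝ} (hγ_var : Summable fun k => |γ k - γ (k + 1)|) (hγ_sq : Summable fun k => γ k ^ 2)
    {V : Z → ℝ} (hV : Measurable V) (hV1 : ∀ z, 1 ≤ V z) {R : ℝ} (hR0 : 0 ≤ R)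
    (hR : ∀ n, ∫⁻ ω, ENNReal.ofReal (V (z n ω) ^ 2) ∂P ≤ ENNReal.ofReal R)
    {G u : T → Z → ℝ} {c L s : ℝ} (hL : 0 ≤ L)
    (hG : Measurable (Function.uncurry G)) (hu : Measurable (Function.uncurry u))
    (hGc : ∀ t z, |G t z| ≤ c * V z) (huc : ∀ t z, |u t z| ≤ c * V z)
    (huL : ∀ t t' z, |u t z - u t' z| ≤ L * dist t t' * V z)
    (huG : ∀ t z, u t z = ∫ y, G t y ∂(κ (t, z)))
    (hstep : ∀ n ω, dist (x (n + 1) ω) (x n ω) ≤ s * |γ (n + 1)| * V (z (n + 1) ω)) :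
    ∀ᵐ ω ∂P, ∃ l, Tendsto (fun n => ∑ k ∈ Finset.range n,
      γ (k + 1) * (G (x k ω) (z (k + 1) ω) - u (x k ω) (z (k + 1) ω))) atTop (𝓝 l) := by
  have hV0 : ∀ z, 0 ≤ V z := fun z => zero_le_one.trans (hV1 z)
  have hx0 : ∀ n, Measurable (x n) := fun n => (hx n).mono (ℱ.le n) le_rfl
  have hz0 : ∀ n, Measurable (z n) := fun n => (hz n).mono (ℱ.le n) le_rfl
  have hVz : ∀ n, Measurable fun ω => V (z n ω) := fun n => hV.comp (hz0 n)
  have hVsq : ∀ n, Integrable (fun ω => V (z n ω) ^ 2) P := fun n => by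
    refine ⟨((hVz n).pow_const 2).aestronglyMeasurable, ?_⟩
    rw [hasFiniteIntegral_iff_ofReal (ae_of_all _ fun ω => sq_nonneg _)]
    exact (hR n).trans_lt ENNReal.ofReal_lt_top
  have hVR : ∀ n, ∫ ω, V (z n ω) ^ 2 ∂P ≤ R := fun n => by
    have := hR n
    rw [← ofReal_integral_eq_lintegral_ofReal (hVsq n) (ae_of_all _ fun ω => sq_nonneg _)] at this
    exact (ENNReal.ofReal_le_ofReal_iff hR0).1 this
  have hVL2 : ∀ n, MemLp (fun ω => V (z n ω)) 2 P := fun n =>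
    (memLp_two_iff_integrable_sq (hVz n).aestronglyMeasurable).2 (hVsq n)
  have hγ1 : Summable fun k => γ (k + 1) ^ 2 := (summable_nat_add_iff 1).2 hγ_sq
  -- the martingale part
  set D : ℕ → Ω → ℝ := fun k ω => γ (k + 1) * (G (x k ω) (z (k + 1) ω) - u (x k ω) (z k ω)) with hD
  have hGk : ∀ k, Measurable[ℱ (k + 1)] fun ω => G (x k ω) (z (k + 1) ω) := fun k =>
    hG.comp (((hx k).mono (ℱ.mono k.le_succ) le_rfl).prodMk (hz (k + 1)))
  have huk : ∀ k, Measurable[ℱ k] fun ω => u (x k ω) (z k ω) := fun k =>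
    hu.comp ((hx k).prodMk (hz k))
  have hGL2 : ∀ k, MemLp (fun ω => G (x k ω) (z (k + 1) ω)) 2 P := fun k =>
    ((hVL2 (k + 1)).const_mul c).mono' ((hGk k).mono (ℱ.le _) le_rfl).aestronglyMeasurable
      (ae_of_all _ fun ω => hGc _ _)
  have huL2 : ∀ k, MemLp (fun ω => u (x k ω) (z k ω)) 2 P := fun k =>
    ((hVL2 k).const_mul c).mono' ((huk k).mono (ℱ.le _) le_rfl).aestronglyMeasurable
      (ae_of_all _ fun ω => huc _ _)
  have hGi : ∀ k, Integrable (fun ω => G (x k ω) (z (k + 1) ω)) P := fun k =>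
    (hGL2 k).integrable (by norm_num)
  have hui : ∀ k, Integrable (fun ω => u (x k ω) (z k ω)) P := fun k =>
    (huL2 k).integrable (by norm_num)
  have hmart : ∀ᵐ ω ∂P, ∃ l, Tendsto (fun n => ∑ k ∈ Finset.range n, D k ω) atTop (𝓝 l) := by
    refine ae_tendsto_sum_of_martingaleDifference (ℱ := ℱ) (fun k => ?_) (fun k => ?_)
      (fun k => ?_) (hγ1.mul_right (4 * c ^ 2 * R)) (fun k => ?_)
    · exact ((hGk k).sub ((huk k).mono (ℱ.mono k.le_succ) le_rfl)).const_mul _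
    · exact ((hGL2 k).sub (huL2 k)).const_mul _
    · have h1 := condExp_eq_integral_kernel (P := P) (ℱ.le k) ((hx k).prodMk (hz k)) (hz0 (k + 1))
        (htr k) (F := fun q => G q.1.1 q.2)
        (hG.comp ((measurable_fst.comp measurable_fst).prodMk measurable_snd)) (hGi k)
      have h2 := condExp_of_stronglyMeasurable (μ := P) (ℱ.le k) (huk k).stronglyMeasurable (hui k)
      have h3 := condExp_sub (hGi k) (hui k) (ℱ k)
      have h4 := condExp_smul (μ := P) (γ (k + 1))
        ((fun ω => G (x k ω) (z (k + 1) ω)) - fun ω => u (x k ω) (z k ω)) (ℱ k)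
      filter_upwards [h1, h3, h4] with ω h1 h3 h4
      have : D k = γ (k + 1) •
          ((fun ω => G (x k ω) (z (k + 1) ω)) - fun ω => u (x k ω) (z k ω)) := rfl
      rw [this, h4, Pi.smul_apply, h3, Pi.sub_apply, h2, ← h1]
      simp [huG]
    -- The constant 4 c² R comes from (a + b)² ≤ 2 (a² + b²) and two second moments, each at most R.
    · have hle : ∀ ω, D k ω ^ 2 ≤
          γ (k + 1) ^ 2 * (2 * c ^ 2) * (V (z (k + 1) ω) ^ 2 + V (z k ω) ^ 2) := fun ω => by
        have h1 : |G (x k ω) (z (k + 1) ω) - u (x k ω) (z k ω)| ≤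
            c * (V (z (k + 1) ω) + V (z k ω)) :=
          (abs_sub _ _).trans (by linarith [hGc (x k ω) (z (k + 1) ω), huc (x k ω) (z k ω)])
        have h2 := pow_le_pow_left₀ (abs_nonneg _) h1 2
        rw [sq_abs] at h2
        calc D k ω ^ 2 = γ (k + 1) ^ 2 *
              (G (x k ω) (z (k + 1) ω) - u (x k ω) (z k ω)) ^ 2 := by rw [hD]; ring
          _ ≤ γ (k + 1) ^ 2 * (c * (V (z (k + 1) ω) + V (z k ω))) ^ 2 := by gcongr
          _ ≤ γ (k + 1) ^ 2 * ((2 * c ^ 2) * (V (z (k + 1) ω) ^ 2 + V (z k ω) ^ 2)) := by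
              refine mul_le_mul_of_nonneg_left ?_ (sq_nonneg _)
              nlinarith [mul_nonneg (sq_nonneg c) (sq_nonneg (V (z (k + 1) ω) - V (z k ω)))]
          _ = _ := by ring
      calc ∫ ω, D k ω ^ 2 ∂P
          ≤ ∫ ω, γ (k + 1) ^ 2 * (2 * c ^ 2) * (V (z (k + 1) ω) ^ 2 + V (z k ω) ^ 2) ∂P :=
            integral_mono (((hGL2 k).sub (huL2 k)).const_mul _).integrable_sq
              (((hVsq _).add (hVsq _)).const_mul _) hle
        _ = γ (k + 1) ^ 2 * (2 * c ^ 2) *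
              (∫ ω, V (z (k + 1) ω) ^ 2 ∂P + ∫ ω, V (z k ω) ^ 2 ∂P) := by
            rw [integral_const_mul, integral_add (hVsq _) (hVsq _)]
        _ ≤ γ (k + 1) ^ 2 * (2 * c ^ 2) * (R + R) := by
            gcongr
            exacts [hVR _, hVR _]
        _ = _ := by ring
  have hsum1 := ae_summable_mul (P := P) (fun k => sq_nonneg (γ k)) hγ_sq
    (fun n ω => sq_nonneg (V (z n ω))) (fun n => (hVz n).pow_const 2) hR
  have hsum2 := ae_summable_mul (P := P) (fun k => abs_nonneg _) hγ_var
    (fun n ω => hV0 (z n ω)) hVz (R := R) (fun n => le_trans (lintegral_mono fun ω =>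
      ENNReal.ofReal_le_ofReal (le_self_pow₀ (hV1 _) two_ne_zero)) (hR n))
  filter_upwards [hmart, hsum1, hsum2] with ω ⟨l, hl⟩ h1 h2
  -- The boundary term vanishes: it is at most c times the square root of γ n² V², the general term
  -- of a convergent series.
  have htele : Tendsto (fun n => γ 0 * u (x 0 ω) (z 0 ω) - γ n * u (x n ω) (z n ω)) atTop
      (𝓝 (γ 0 * u (x 0 ω) (z 0 ω) - 0)) := by
    refine Tendsto.const_sub _ ?_
    have h3 : Tendsto (fun n => c * √(γ n ^ 2 * V (z n ω) ^ 2)) atTop (𝓝 0) := by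
      simpa using (h1.tendsto_atTop_zero.sqrt).const_mul c
    refine squeeze_zero_norm (fun n => ?_) h3
    rw [← mul_pow, Real.sqrt_sq_eq_abs, Real.norm_eq_abs, abs_mul, abs_mul, abs_of_nonneg (hV0 _)]
    nlinarith [huc (x n ω) (z n ω), abs_nonneg (γ n)]
  have hvar : Summable fun k => (γ (k + 1) - γ k) * u (x k ω) (z k ω) := by
    refine Summable.of_norm_bounded (h2.mul_left c) fun k => ?_
    rw [Real.norm_eq_abs, abs_mul, abs_sub_comm]
    nlinarith [huc (x k ω) (z k ω), abs_nonneg (γ k - γ (k + 1))]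
  -- One factor γ V comes from the increment of x; the prefactor γ and the weight in `huL` supply
  -- the other.
  have hpar : Summable fun k =>
      γ (k + 1) * (u (x (k + 1) ω) (z (k + 1) ω) - u (x k ω) (z (k + 1) ω)) := by
    refine Summable.of_norm_bounded (((summable_nat_add_iff 1).2 h1).mul_left (L * s)) fun k => ?_
    rw [Real.norm_eq_abs, abs_mul]
    calc |γ (k + 1)| * |u (x (k + 1) ω) (z (k + 1) ω) - u (x k ω) (z (k + 1) ω)|
        ≤ |γ (k + 1)| * (L * (s * |γ (k + 1)| * V (z (k + 1) ω)) * V (z (k + 1) ω)) := by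
          refine mul_le_mul_of_nonneg_left ((huL _ _ _).trans ?_) (abs_nonneg _)
          exact mul_le_mul_of_nonneg_right (mul_le_mul_of_nonneg_left (hstep k ω) hL) (hV0 _)
      _ = L * s * (γ (k + 1) ^ 2 * V (z (k + 1) ω) ^ 2) := by rw [← sq_abs (γ (k + 1))]; ring
  refine ⟨_, (((hl.add htele).add hvar.hasSum.tendsto_sum_nat).add
    hpar.hasSum.tendsto_sum_nat).congr fun n => ?_⟩
  rw [← Finset.sum_range_sub' (fun k => γ k * u (x k ω) (z k ω)), ← Finset.sum_add_distrib,
    ← Finset.sum_add_distrib, ← Finset.sum_add_distrib]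
  refine Finset.sum_congr rfl fun k _ => ?_
  simp only [hD]
  ring

end Noise

/-! ### Increments of the proximal schemes -/

section Increments

variable {E : Type*} [NormedAddCommGroup E]

/-- A locally Lipschitz function which is bounded below decreases at most linearly away from a
compact set. -/
lemma exists_sub_le_mul_norm {X K : Set E} {g : E → ℝ} (hg : LocallyLipschitzOn X g)
    (hbdd : BddBelow (g '' X)) (hK : IsCompact K) (hKX : K ⊆ X) :
    ∃ L : ℝ, 0 ≤ L ∧ ∀ x ∈ K, ∀ a ∈ X, g x - g a ≤ L * ‖a - x‖ := by
  obtain ⟨m, hm⟩ := hbdd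
  have hm' : ∀ a ∈ X, m ≤ g a := fun a ha => hm (mem_image_of_mem g ha)
  refine hK.induction_on (p := fun s => ∃ L : ℝ, 0 ≤ L ∧ ∀ x ∈ s, ∀ a ∈ X,
    g x - g a ≤ L * ‖a - x‖) ⟨0, le_rfl, by simp⟩
    (fun s t hst ⟨L, hL, h⟩ => ⟨L, hL, fun x hx => h x (hst hx)⟩)
    (fun s t ⟨L, hL, h⟩ ⟨L', hL', h'⟩ => ⟨max L L', le_max_of_le_left hL, ?_⟩) ?_
  · rintro x (hx | hx) a ha
    · exact (h x hx a ha).trans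
        (mul_le_mul_of_nonneg_right (le_max_left _ _) (norm_nonneg _))
    · exact (h' x hx a ha).trans
        (mul_le_mul_of_nonneg_right (le_max_right _ _) (norm_nonneg _))
  · intro x₀ hx₀
    obtain ⟨C, t, ht, hC⟩ := hg (hKX hx₀)
    obtain ⟨ε, hε, hεt⟩ := Metric.mem_nhdsWithin_iff.1 ht
    have hx₀t : x₀ ∈ t := hεt ⟨Metric.mem_ball_self hε, hKX hx₀⟩
    have hlip : ∀ x ∈ t, ∀ y ∈ t, g x - g y ≤ C * ‖y - x‖ := fun x hx y hy => by
      have := hC.dist_le_mul x hx y hy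
      rw [Real.dist_eq, dist_eq_norm, norm_sub_rev] at this
      exact (le_abs_self _).trans this
    have hD0 : 0 ≤ g x₀ + C * ε - m := by
      have := hm' x₀ (hKX hx₀)
      have : 0 ≤ C * ε := by positivity
      linarith
    -- Near x the constant C suffices; at distance at least ε / 2 the total possible decrease of g,
    -- at most g x₀ + C ε - m, is spread over that distance.
    have hA : 0 ≤ (g x₀ + C * ε - m) / (ε / 2) := by positivity
    refine ⟨Metric.ball x₀ (ε / 2) ∩ K,
      inter_mem (mem_nhdsWithin_of_mem_nhds (Metric.ball_mem_nhds _ (by positivity)))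
        self_mem_nhdsWithin, C + (g x₀ + C * ε - m) / (ε / 2), by positivity, ?_⟩
    rintro x ⟨hx, hxK⟩ a ha
    rw [add_mul]
    have hxd : ‖x - x₀‖ < ε / 2 := by simpa [dist_eq_norm] using hx
    have hxt : x ∈ t := hεt ⟨Metric.ball_subset_ball (by linarith) hx, hKX hxK⟩
    by_cases hax : ‖a - x‖ < ε / 2
    · have hat : a ∈ t := hεt ⟨by
        rw [Metric.mem_ball, dist_eq_norm]
        calc ‖a - x₀‖ ≤ ‖a - x‖ + ‖x - x₀‖ := norm_sub_le_norm_sub_add_norm_sub _ _ _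
          _ < ε := by linarith, ha⟩
      have := hlip x hxt a hat
      have : 0 ≤ (g x₀ + C * ε - m) / (ε / 2) * ‖a - x‖ := by positivity
      linarith
    · have h1 := hlip x hxt x₀ hx₀t
      rw [norm_sub_rev] at h1
      have h2 : (C : ℝ) * ‖x - x₀‖ ≤ C * ε := by gcongr; linarith
      have h3 : g x₀ + C * ε - m ≤ (g x₀ + C * ε - m) / (ε / 2) * ‖a - x‖ := by
        rw [div_mul_eq_mul_div, le_div_iff₀ (by positivity)]
        exact mul_le_mul_of_nonneg_left (not_lt.1 hax) hD0
      have h4 : 0 ≤ (C : ℝ) * ‖a - x‖ := by positivity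
      linarith [hm' a ha]

variable [InnerProductSpace ℝ E]

/-- Compare the minimizer y with the competitor x. With t = ‖y - x‖, the reverse triangle inequality
gives (t - γ‖H‖)² ≤ (γ‖H‖)² + 2 γ L t; the squares of γ‖H‖ cancel and t divides out. -/
lemma norm_sub_le_of_prox_le {γ L a b : ℝ} (hγ : 0 < γ) {x y H : E} (hL : a - b ≤ L * ‖y - x‖)
    (hL0 : 0 ≤ L) (hmin : b + (2 * γ)⁻¹ * ‖y - (x - γ • H)‖ ^ 2 ≤
      a + (2 * γ)⁻¹ * ‖x - (x - γ • H)‖ ^ 2) : ‖y - x‖ ≤ 2 * γ * (L + ‖H‖) := by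
  rw [sub_sub_cancel, norm_smul, Real.norm_of_nonneg hγ.le] at hmin
  have h1 : |‖y - x‖ - γ * ‖H‖| ≤ ‖y - (x - γ • H)‖ := by
    have := abs_norm_sub_norm_le (y - x) (-(γ • H))
    rwa [norm_neg, norm_smul, Real.norm_of_nonneg hγ.le,
      show y - x - -(γ • H) = y - (x - γ • H) by abel] at this
  have h2 := pow_le_pow_left₀ (abs_nonneg _) h1 2
  rw [sq_abs] at h2
  have h3 : (2 * γ)⁻¹ * (‖y - (x - γ • H)‖ ^ 2 - (γ * ‖H‖) ^ 2) ≤ L * ‖y - x‖ := by linarith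
  rw [inv_mul_le_iff₀ (by positivity)] at h3
  have h4 : ‖y - x‖ * ‖y - x‖ ≤ 2 * γ * (L + ‖H‖) * ‖y - x‖ := by nlinarith
  rcases (norm_nonneg (y - x)).eq_or_lt with h | h
  · rw [← h]; positivity
  · exact le_of_mul_le_mul_right h4 h

lemma norm_sub_le_of_mem_prox {X K : Set E} {g : E → ℝ} {L : ℝ} (hL0 : 0 ≤ L)
    (hL : ∀ x ∈ K, ∀ a ∈ X, g x - g a ≤ L * ‖a - x‖) (hKX : K ⊆ X) {γ : ℝ} (hγ : 0 < γ)
    {x y H : E} (hx : x ∈ K) (hy : y ∈ prox X γ (fun y => (g y : EReal)) (x - γ • H)) :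
    ‖y - x‖ ≤ 2 * γ * (L + ‖H‖) := by
  have h := hy.2 x (hKX hx)
  dsimp only at h
  exact norm_sub_le_of_prox_le hγ (hL x hx y hy.1) hL0 (by exact_mod_cast h)

lemma mem_and_norm_sub_le_of_mem_prox_indicator {X K : Set E} {g : E → ℝ} {L : ℝ} (hL0 : 0 ≤ L)
    (hL : ∀ x ∈ K, ∀ a ∈ X, g x - g a ≤ L * ‖a - x‖) (hKX : K ⊆ X) {γ : ℝ} (hγ : 0 < γ)
    {x y H : E} (hx : x ∈ K)
    (hy : y ∈ prox X γ (fun y => (g y : EReal) + convexIndicator K y) (x - γ • H)) :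
    y ∈ K ∧ ‖y - x‖ ≤ 2 * γ * (L + ‖H‖) := by
  have h := hy.2 x (hKX hx)
  -- Outside K the objective is +∞, whereas the competitor x has a finite value.
  have hyK : y ∈ K := by
    by_contra hyK
    simp only [convexIndicator, if_pos hx, if_neg hyK, add_zero, EReal.coe_add_top,
      EReal.top_add_coe, top_le_iff] at h
    rw [← EReal.coe_add] at h
    exact EReal.coe_ne_top _ h
  simp only [convexIndicator, if_pos hx, if_pos hyK, add_zero] at h
  exact ⟨hyK, norm_sub_le_of_prox_le hγ (hL x hx y hy.1) hL0 (by exact_mod_cast h)⟩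

/-- Both schemes stay in `K` and have increments of the order of the step size times the size of
the gradient estimate. -/
lemma mem_and_norm_sub_le_of_scheme {X K : Set E} {g : E → ℝ} {L : ℝ} (hL0 : 0 ≤ L)
    (hL : ∀ x ∈ K, ∀ a ∈ X, g x - g a ≤ L * ‖a - x‖) (hKX : K ⊆ X) {γ : ℕ → ℝ}
    (hγ : ∀ k, 1 ≤ k → 0 < γ k) {x H : ℕ → E} (hx0 : x 0 ∈ K)
    (hx : IndicatorProxScheme X K g γ x H ∨ ProjectedProxScheme X K g γ x H) :
    (∀ k, x k ∈ K) ∧ ∀ k, ‖x (k + 1) - x k‖ ≤ 4 * γ (k + 1) * (L + ‖H (k + 1)‖) := by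
  have step : ∀ k, x k ∈ K →
      x (k + 1) ∈ K ∧ ‖x (k + 1) - x k‖ ≤ 4 * γ (k + 1) * (L + ‖H (k + 1)‖) := by
    intro k hk
    have hγk := hγ (k + 1) (Nat.le_add_left 1 k)
    have hpos : 0 ≤ γ (k + 1) * (L + ‖H (k + 1)‖) := by positivity
    rcases hx with h | h
    · have := mem_and_norm_sub_le_of_mem_prox_indicator hL0 hL hKX hγk hk (h k)
      exact ⟨this.1, by linarith [this.2]⟩
    -- As x k lies in K, projecting moves a by at most ‖a - x k‖; this doubles the constant 2 into
    -- 4.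
    · obtain ⟨a, ha, hpK, hp⟩ := h k
      have h1 := norm_sub_le_of_mem_prox hL0 hL hKX hγk hk ha
      have h2 := norm_sub_le_norm_sub_add_norm_sub (x (k + 1)) a (x k)
      rw [norm_sub_rev (x (k + 1)) a] at h2
      exact ⟨hpK, by linarith [hp _ hk]⟩
  have hmem : ∀ k, x k ∈ K := fun k => by
    induction k with
    | zero => exact hx0
    | succ k ih => exact (step k ih).1
  exact ⟨hmem, fun k => (step k (hmem k)).2⟩

end Increments

/-! ### Joint measurability and convergence of series -/

lemma continuous_of_abs_sub_le {T : Type*} [PseudoMetricSpace T] {F : T → ℝ} {A : ℝ}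
    (h : ∀ t t', |F t - F t'| ≤ A * dist t t') :
    Continuous F :=
  (LipschitzWith.of_dist_le_mul (K := A.toNNReal) fun t t' => (h t t').trans
    (mul_le_mul_of_nonneg_right (Real.le_coe_toNNReal A) dist_nonneg)).continuous

/-- A kernel depending on a Lipschitz parameter is jointly measurable. -/
lemma exists_kernel_of_lipschitz {Z T : Type*} [MeasurableSpace Z] [MetricSpace T]
    [SecondCountableTopology T] [MeasurableSpace T] [OpensMeasurableSpace T] {Q : T → Kernel Z Z}
    [∀ t, IsMarkovKernel (Q t)] {V : Z → ℝ} (hV : ∀ z, 1 ≤ V z) {L : ℝ}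
    (hD : ∀ t t', ∀ φ : Z → ℝ, Measurable φ → (∀ y, |φ y| ≤ 1 * V y) →
      ∀ z, |∫ y, φ y ∂(Q t z) - ∫ y, φ y ∂(Q t' z)| ≤ 1 * (L * dist t t') * V z) :
    ∃ κ : Kernel (T × Z) Z, IsMarkovKernel κ ∧ ∀ t z, κ (t, z) = Q t z := by
  have hmeas : Measurable fun q : T × Z => Q q.1 q.2 := by
    refine Measure.measurable_of_measurable_coe _ fun A hA => ?_
    -- A Carathéodory function: Lipschitz in t, since the indicator of A is at most 1 ≤ V, and
    -- measurable in z.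
    have h1 : Measurable (Function.uncurry fun t z => (Q t z).real A) := by
      refine measurable_uncurry_of_continuous_of_measurable (fun z => ?_) fun t =>
        (Kernel.measurable_coe (Q t) hA).ennreal_toReal
      refine continuous_of_abs_sub_le (A := L * V z) fun t t' => ?_
      have := hD t t' (A.indicator fun _ => 1) (measurable_const.indicator hA) (fun y => by
        rw [one_mul]
        refine le_trans ?_ (hV y)
        by_cases hy : y ∈ A <;> simp [hy]) z
      rw [integral_indicator_const _ hA, integral_indicator_const _ hA] at this
      simp only [smul_eq_mul, mul_one] at this
      linarith
    have h2 : (fun q : T × Z => Q q.1 q.2 A) =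
        fun q => ENNReal.ofReal (Function.uncurry (fun t z => (Q t z).real A) q) := by
      ext q
      simp [Function.uncurry]
    rw [h2]
    exact h1.ennreal_ofReal
  exact ⟨⟨_, hmeas⟩, ⟨fun q => inferInstanceAs (IsProbabilityMeasure (Q q.1 q.2))⟩,
    fun _ _ => rfl⟩

/-- The sums start at index 2 because the Poisson decomposition runs from time 1; the term of index
1 is added by hand. -/
lemma seriesConverges_of_forall_apply {d : ℕ} {v : ℕ → EuclideanSpace ℝ (Fin d)}
    (h : ∀ i, ∃ l, Tendsto (fun n => ∑ k ∈ Finset.range n, v (k + 2) i) atTop (𝓝 l)) :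
    SeriesConverges v := by
  choose l hl using h
  refine ⟨v 1 + WithLp.toLp 2 l, (tendsto_add_atTop_iff_nat 1).1 ?_⟩
  have h1 : Tendsto (fun n => WithLp.toLp 2 fun i => ∑ k ∈ Finset.range n, v (k + 2) i) atTop
      (𝓝 (WithLp.toLp 2 l)) :=
    ((PiLp.continuous_toLp 2 fun _ : Fin d => ℝ).tendsto _).comp (tendsto_pi_nhds.2 hl)
  refine (h1.const_add (v 1)).congr fun n => ?_
  rw [← Finset.sum_Ioc_add_eq_sum_Icc (Nat.le_add_left 1 n), add_comm]
  congr 1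
  have : Finset.Ioc 1 (n + 1) = Finset.Ico 2 (n + 2) := by
    ext k; simp; omega
  rw [this, Finset.sum_Ico_eq_sum_range]
  ext i
  simp [add_comm]

end ProxSGD

end

/-! ### Assembly: Poisson decomposition of the noise of the two schemes, coordinate by coordinate -/

theorem mainTheorem8 {d : ℕ} {Z Ω : Type*} [MeasurableSpace Z] [MeasurableSpace Ω]
    (P : Measure Ω) [IsProbabilityMeasure P]
    (X K : Set (EuclideanSpace ℝ (Fin d)))
    (hK_ne : K.Nonempty) (hK_compact : IsCompact K) (hK_convex : Convex ℝ K) (hKX : K ⊆ X)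
    (f g : EuclideanSpace ℝ (Fin d) → ℝ) (hfg : ProxSGD.CompositeObjective X f g)
    (γ : ℕ → ℝ) (hγ : ProxSGD.StepSizes γ)
    (hγ_var : Summable fun k => |γ k - γ (k + 1)|) (hγ_sq : Summable fun k => γ k ^ 2)
    (Φ : EuclideanSpace ℝ (Fin d) → Z → EuclideanSpace ℝ (Fin d))
    (hΦ_meas : Measurable fun p : K × Z => Φ p.1 p.2)
    (M : EuclideanSpace ℝ (Fin d) → Kernel Z Z) (π : EuclideanSpace ℝ (Fin d) → Measure Z)
    (hM : ∀ x ∈ X, IsMarkovKernel (M x)) (hπ : ∀ x ∈ X, IsProbabilityMeasure (π x))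
    (hMπ : ∀ x ∈ X, Kernel.Invariant (M x) (π x))
    (hΦ_int : ∀ x ∈ K, Integrable (Φ x) (π x))
    (hΦ : ∀ x ∈ K, gradient f x = ∫ z, Φ x z ∂(π x))
    (W : Z → ℝ) (hB1 : ProxSGD.UniformlyErgodic K Φ M π W)
    (hB2 : ProxSGD.LipschitzInParameter K Φ M W)
    (ℱ : Filtration ℕ ‹MeasurableSpace Ω›)
    (x : ℕ → Ω → EuclideanSpace ℝ (Fin d)) (z : ℕ → Ω → Z)
    (hz : ProxSGD.MarkovianDynamic P ℱ M x z)
    (hW : Integrable (fun ω => W (z 1 ω)) P)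
    (hx0 : ∀ ω, x 0 ω ∈ K)
    (hx :
      (∀ ω, ProxSGD.IndicatorProxScheme X K g γ (fun k => x k ω)
        (fun k => Φ (x (k - 1) ω) (z k ω))) ∨
      (∀ ω, ProxSGD.ProjectedProxScheme X K g γ (fun k => x k ω)
        (fun k => Φ (x (k - 1) ω) (z k ω)))) :
    (∀ᵐ ω ∂P, ProxSGD.NoiseCondition γ
      (fun k => Φ (x (k - 1) ω) (z k ω) - gradient f (x (k - 1) ω))) ∧
    (∀ᵐ ω ∂P, ProxSGD.SeriesConverges
      (fun k => γ k • (Φ (x (k - 1) ω) (z k ω) - gradient f (x (k - 1) ω)))) := by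
  -- Convergence of the whole noise series gives the decomposition with e = δ and r = 0.
  suffices key : ∀ᵐ ω ∂P, ProxSGD.SeriesConverges
      (fun k => γ k • (Φ (x (k - 1) ω) (z k ω) - gradient f (x (k - 1) ω))) from
    ⟨key.mono fun ω h => ⟨_, fun _ => 0, fun k _ => (add_zero _).symm, by simp, h⟩, key⟩
  -- deterministic bounds
  obtain ⟨Lg, hLg0, hLg⟩ := ProxSGD.exists_sub_le_mul_norm hfg.locallyLipschitz hfg.bddBelow
    hK_compact hKX
  have hscheme : ∀ ω, (∀ k, x k ω ∈ K) ∧ ∀ k, ‖x (k + 1) ω - x k ω‖ ≤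
      4 * γ (k + 1) * (Lg + ‖Φ (x k ω) (z (k + 1) ω)‖) := fun ω =>
    ProxSGD.mem_and_norm_sub_le_of_scheme hLg0 hLg hKX hγ.pos (x := fun k => x k ω)
      (H := fun k => Φ (x (k - 1) ω) (z k ω)) (hx0 ω) (hx.imp (fun h => h ω) fun h => h ω)
  have hxK : ∀ k ω, x k ω ∈ K := fun k ω => (hscheme ω).1 k
  set V : Z → ℝ := fun z => W z ^ (1 / 2 : ℝ) with hVdef
  have hV1 : ∀ z, 1 ≤ V z := fun z => Real.one_le_rpow (hB1.one_le_weight z) (by norm_num)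
  have hVsq : ∀ z, V z ^ 2 = W z := fun z => by
    simp only [hVdef]
    rw [← Real.sqrt_eq_rpow, Real.sq_sqrt (by linarith [hB1.one_le_weight z])]
  have hW0 : ∀ z, 0 ≤ W z := fun z => by linarith [hB1.one_le_weight z]
  have hVm : Measurable V := hB1.measurable_weight.pow_const _
  obtain ⟨C, ρ, B, hB0, hgeom⟩ := hB1.exists_isGeomErgodic (fun x hx => hM x (hKX hx))
    (fun x hx => hπ x (hKX hx)) fun x hx => hMπ x (hKX hx)
  obtain ⟨L, hL0, hL⟩ := hB2.exists_const hB1.one_le_weight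
  have hD : ∀ x ∈ K, ∀ x' ∈ K, ∀ (φ : Z → ℝ) (c : ℝ), Measurable φ → (∀ y, |φ y| ≤ c * V y) →
      ∀ z, |∫ y, φ y ∂(M x z) - ∫ y, φ y ∂(M x' z)| ≤ c * (L * ‖x - x'‖) * V z :=
    fun x hx x' hx' φ c hφ hφc z => (hL x hx x' hx').2 φ c hφ hφc z
      ((hgeom x hx).1.integrable_kernel z) ((hgeom x' hx').1.integrable_kernel z)
  obtain ⟨c, hc0, hΦc⟩ : ∃ c : ℝ, 0 ≤ c ∧ ∀ x ∈ K, ∀ z, ‖Φ x z‖ ≤ c * V z := by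
    refine ⟨(⨆ x ∈ K, ProxSGD.wNorm V (Φ x)).toReal, ENNReal.toReal_nonneg, fun x hx =>
      ProxSGD.norm_le_of_wNorm_le hV1 ENNReal.toReal_nonneg ?_⟩
    rw [ENNReal.ofReal_toReal hB1.gradient_bound.ne]
    exact le_iSup₂ (f := fun x _ => ProxSGD.wNorm V (Φ x)) x hx
  -- the chain after the first step
  have hMK : ∀ t : K, IsMarkovKernel (M t) := fun t => hM t (hKX t.2)
  -- The kernels depend on the parameter in a controlled way only on K, so the parameter space is
  -- the subtype K.
  obtain ⟨κ, hκ, hκM⟩ := ProxSGD.exists_kernel_of_lipschitz (T := K) (Q := fun t => M t) hV1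
    (L := L) fun t t' φ hφ hφ1 z => hD t t.2 t' t'.2 φ 1 hφ hφ1 z
  -- Nothing is known of z 0 and transitions start at k = 1, hence the shift of time by one.
  let 𝒢 : Filtration ℕ ‹MeasurableSpace Ω› :=
    ⟨fun n => ℱ (n + 1), fun i j hij => ℱ.mono (by omega), fun n => ℱ.le _⟩
  let x' : ℕ → Ω → K := fun n ω => ⟨x (n + 1) ω, hxK _ ω⟩
  let z' : ℕ → Ω → Z := fun n => z (n + 1)
  have hx' : ∀ n, Measurable[𝒢 n] (x' n) := fun n => (hz.measurable_param (n + 1)).subtype_mk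
  have hz' : ∀ n, Measurable[𝒢 n] (z' n) := fun n => hz.measurable_sample (n + 1) (by omega)
  have htr : ∀ n A, MeasurableSet A →
      P⟦z' (n + 1) ⁻¹' A|𝒢 n⟧ =ᵐ[P] fun ω => (κ (x' n ω, z' n ω)).real A := fun n A hA => by
    simp_rw [hκM]
    exact hz.transition (n + 1) (by omega) A hA
  obtain ⟨lam, b, hlam0, hlam1, hdrift⟩ := hB1.drift
  obtain ⟨R, hR0, hR⟩ := ProxSGD.exists_lintegral_weight_le hx' hz' htr hB1.measurable_weight hW0
    hlam0 hlam1 (b := b) (fun t z => by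
      rw [hκM]
      exact (le_iSup₂ (f := fun x _ => ∫⁻ y, ENNReal.ofReal (W y) ∂(M x z)) t.1 t.2).trans
        (hdrift z)) hW
  have hR' : ∀ n, ∫⁻ ω, ENNReal.ofReal (V (z' n ω) ^ 2) ∂P ≤ ENNReal.ofReal R := by
    simp_rw [hVsq]
    exact hR
  have hγ_var' : Summable fun k => |γ (k + 1) - γ (k + 1 + 1)| :=
    (summable_nat_add_iff (f := fun k => |γ k - γ (k + 1)|) 1).2 hγ_var
  have hγ_sq' : Summable fun k => γ (k + 1) ^ 2 :=
    (summable_nat_add_iff (f := fun k => γ k ^ 2) 1).2 hγ_sq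
  -- As V ≥ 1, Lg + ‖Φ‖ ≤ (Lg + c) V, so one weight absorbs both terms.
  have hstep : ∀ n ω, dist (x' (n + 1) ω) (x' n ω) ≤
      4 * (Lg + c) * |γ (n + 1 + 1)| * V (z' (n + 1) ω) := fun n ω => by
    have hγn := hγ.pos (n + 1 + 1) (by omega)
    have h1 := (hscheme ω).2 (n + 1)
    have h2 := hΦc _ (hxK (n + 1) ω) (z (n + 1 + 1) ω)
    have h3 := le_mul_of_one_le_right hLg0 (hV1 (z (n + 1 + 1) ω))
    rw [abs_of_pos hγn, Subtype.dist_eq, dist_eq_norm]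
    calc _ ≤ _ := h1
      _ ≤ 4 * γ (n + 1 + 1) * (Lg * V (z (n + 1 + 1) ω) + c * V (z (n + 1 + 1) ω)) := by
        gcongr
      _ = _ := by ring
  have hcoord : ∀ i, ∀ᵐ ω ∂P, ∃ l, Tendsto (fun n => ∑ k ∈ Finset.range n,
      (γ (k + 2) • (Φ (x (k + 1) ω) (z (k + 2) ω) - gradient f (x (k + 1) ω))) i) atTop (𝓝 l) := by
    intro i
    have hm : ∀ x ∈ K, Measurable fun z => Φ x z i := fun x hx =>
      (EuclideanSpace.proj (𝕜 := ℝ) i).measurable.comp (hΦ_meas.comp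
        (measurable_const.prodMk measurable_id : Measurable fun z : Z => ((⟨x, hx⟩ : K), z)))
    have hhc : ∀ x ∈ K, ∀ z, |Φ x z i| ≤ c * V z := fun x hx z =>
      (PiLp.norm_apply_le (Φ x z) i).trans (hΦc x hx z)
    have hhL : ∀ x ∈ K, ∀ x' ∈ K, ∀ z, |Φ x z i - Φ x' z i| ≤ L * ‖x - x'‖ * V z :=
      fun x hx x' hx' z => (PiLp.norm_apply_le (Φ x z - Φ x' z) i).trans ((hL x hx x' hx').1 z)
    obtain ⟨G, u, c', L', hc', hL', hGm, hum, hGc, huc, hGL, huL, huG, hGu⟩ :=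
      ProxSGD.exists_poisson_family hB0 hL0 hc0 (fun x hx => (hgeom x hx).1)
        (fun x hx => (hgeom x hx).2) hD (h := fun x z => Φ x z i) hm hhc hhL
    have hjoint : ∀ F : EuclideanSpace ℝ (Fin d) → Z → ℝ, (∀ x ∈ K, Measurable (F x)) →
        (∀ x ∈ K, ∀ x' ∈ K, ∀ z, |F x z - F x' z| ≤ L' * ‖x - x'‖ * V z) →
        Measurable (Function.uncurry fun (t : K) z => F t z) := fun F hFm hFL =>
      measurable_uncurry_of_continuous_of_measurable
        (fun z => ProxSGD.continuous_of_abs_sub_le (A := L' * V z) fun t t' =>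
          (hFL t t.2 t' t'.2 z).trans_eq (by rw [Subtype.dist_eq, dist_eq_norm]; ring))
        fun t => hFm t t.2
    have := ProxSGD.ae_tendsto_sum_noise (G := fun (t : K) z => G t z)
      (u := fun (t : K) z => u t z) (γ := fun k => γ (k + 1)) hx' hz' htr hγ_var' hγ_sq' hVm hV1
      hR0 hR' hL' (hjoint G hGm hGL) (hjoint u hum huL) (fun t => hGc t t.2) (fun t => huc t t.2)
      (fun t t' z => huL t t.2 t' t'.2 z) (fun t z => by rw [hκM]; exact huG t t.2 z) hstep
    filter_upwards [this] with ω ⟨l, hl⟩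
    refine ⟨l, hl.congr fun n => Finset.sum_congr rfl fun k _ => ?_⟩
    have hgrad : gradient f (x (k + 1) ω) i =
        ∫ y, Φ (x (k + 1) ω) y i ∂(π (x (k + 1) ω)) := by
      rw [hΦ _ (hxK _ ω)]
      exact ((EuclideanSpace.proj (𝕜 := ℝ) i).integral_comp_comm (hΦ_int _ (hxK _ ω))).symm
    rw [PiLp.smul_apply, PiLp.sub_apply, hgrad, smul_eq_mul]
    exact congrArg _ (hGu _ (hxK (k + 1) ω) _)
  filter_upwards [ae_all_iff.2 hcoord] with ω hω
  exact ProxSGD.seriesConverges_of_forall_apply hω
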